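/- Let $\mathbb{K}\in\{\mathbb{R},\mathbb{C}\}$ and let $\mathsf{cBorn}$ be the category of complete convex bornological $\mathbb{K}$-vector spaces and bounded linear maps, with the complete tensor product $\hat\otimes$ (the completion of the algebraic tensor product, in which the bounded sets are the subsets of the disked hulls of sets $\{s\otimes t : s\in S,\ t\in T\}$ with $S$, $T$ bounded). Let $A$ be a (not necessarily unital) associative algebra in $\mathsf{cBorn}$ with multiplication $\mu: A\hat\otimes A\to A$. Assume that $A$ has a strong approximate right unit, that is, a sequence $(e_n)_{n\in\mathbb{N}}$ in $A$ such that the right multiplications $r_{e_n}: A\to A$, $a\mapsto a e_n$, converge to $\mathrm{id}_A$ in the sense of Mackey in the space $\underline{\mathrm{Hom}}(A,A)$ of bounded linear maps with the equibounded bornology (convergence of a sequence with respect to the Minkowski functional of some bounded disk). Let $M$ be a right $A$-module in $\mathsf{cBorn}$ with action $\rho: M\hat\otimes A\to M$, and let $M\hat\otimes_A A$ be the coequalizer in $\mathsf{cBorn}$ of the two morphisms $\rho\hat\otimes\mathrm{id}_A$ and $\mathrm{id}_M\hat\otimes\mu$ from $M\hat\otimes A\hat\otimes A$ to $M\hat\otimes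 A$. Then: 1. The morphism $\tilde\rho: M\hat\otimes_A A\to M$ induced by $\rho$ is injective, and hence a monomorphism in $\mathsf{cBorn}$. 2. $M$ is smooth, i.e. $\tilde\rho$ is an isomorphism in $\mathsf{cBorn}$, if and only if $\rho: M\hat\otimes A\to M$ is a strong epimorphism in $\mathsf{cBorn}$, i.e. an epimorphism with the left lifting property with respect to all monomorphisms. -/

import Mathlib

open CategoryTheory Limits Bornology
open scoped Pointwise TensorProduct

universe u

/-! ## Disks, Mackey convergence, completant disks -/

section Disks

variable (𝕜 : Type) [RCLike 𝕜] {V : Type*} [AddCommGroup V] [Module 𝕜 V]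

/-- A disk, i.e. a circled convex set: `a D + b D ⊆ D` whenever `|a| + |b| ≤ 1`. -/
def IsDisk (D : Set V) : Prop :=
  ∀ x ∈ D, ∀ y ∈ D, ∀ a b : 𝕜, ‖a‖ + ‖b‖ ≤ 1 → a • x + b • y ∈ D

/-- The disked hull of a set: the smallest disk that contains it. -/
def diskHull (S : Set V) : Set V := ⋂₀ {D | IsDisk 𝕜 D ∧ S ⊆ D}

/-- The sequence `x` converges to `v` with respect to the Minkowski functional of `D`. -/
def DiskTendsto (D : Set V) (x : ℕ → V) (v : V) : Prop :=
  ∀ ε : ℝ, 0 < ε → ∃ N : ℕ, ∀ n ≥ N, x n - v ∈ (ε : 𝕜) • D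

/-- The sequence `x` is Cauchy with respect to the Minkowski functional of `D`. -/
def DiskCauchy (D : Set V) (x : ℕ → V) : Prop :=
  ∀ ε : ℝ, 0 < ε → ∃ N : ℕ, ∀ m ≥ N, ∀ n ≥ N, x m - x n ∈ (ε : 𝕜) • D

/-- The Minkowski functional of the disk `D` is a norm on the span of `D`: only `0` lies in all
`ε D` with `ε > 0`. -/
def IsNorming (D : Set V) : Prop :=
  ∀ v : V, (∀ ε : ℝ, 0 < ε → v ∈ (ε : 𝕜) • D) → v = 0

/-- A completant disk: a norming disk whose span is complete in the Minkowski norm. (A Cauchy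
sequence is, up to a constant and finitely many terms, a sequence in the span of `D`.) -/
structure IsCompletant (D : Set V) : Prop where
  disk : IsDisk 𝕜 D
  norming : IsNorming 𝕜 D
  complete : ∀ x : ℕ → V, DiskCauchy 𝕜 D x → ∃ v : V, DiskTendsto 𝕜 D x v

variable {𝕜}

theorem IsDisk.zero_mem {D : Set V} (hD : IsDisk 𝕜 D) {x : V} (hx : x ∈ D) : (0 : V) ∈ D := by
  have := hD x hx x hx 0 0 (by simp)
  simpa using this

theorem IsDisk.smul_mem {D : Set V} (hD : IsDisk 𝕜 D) {x : V} (hx : x ∈ D) {a : 𝕜}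
    (ha : ‖a‖ ≤ 1) : a • x ∈ D := by
  have := hD x hx x hx a 0 (by simpa using ha)
  simpa using this

/-- `a D ⊆ r D` for `|a| ≤ r`. -/
theorem IsDisk.smul_mem_smul {D : Set V} (hD : IsDisk 𝕜 D) {x : V} (hx : x ∈ D) {a : 𝕜} {r : ℝ}
    (hr : 0 < r) (ha : ‖a‖ ≤ r) : a • x ∈ (r : 𝕜) • D := by
  have hr' : (r : 𝕜) ≠ 0 := by exact_mod_cast hr.ne'
  refine Set.mem_smul_set.2 ⟨((r : 𝕜)⁻¹ * a) • x, hD.smul_mem hx ?_, ?_⟩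
  · rw [norm_mul, norm_inv, RCLike.norm_ofReal, abs_of_pos hr, inv_mul_le_iff₀ hr]
    simpa using ha
  · rw [smul_smul, mul_inv_cancel_left₀ hr']

theorem IsDisk.mono_smul {D : Set V} (hD : IsDisk 𝕜 D) {r s : ℝ} (hr : 0 < r) (hrs : r ≤ s) :
    (r : 𝕜) • D ⊆ (s : 𝕜) • D := by
  rintro _ ⟨d, hd, rfl⟩
  exact hD.smul_mem_smul hd (hr.trans_le hrs)
    (by rw [RCLike.norm_ofReal, abs_of_pos hr]; exact hrs)

/-- `a D + b D ⊆ r D` for `|a| + |b| ≤ r`. -/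
theorem IsDisk.comb_mem {D : Set V} (hD : IsDisk 𝕜 D) {x y : V} (hx : x ∈ D) (hy : y ∈ D)
    {a b : 𝕜} {r : ℝ} (hr : 0 < r) (h : ‖a‖ + ‖b‖ ≤ r) : a • x + b • y ∈ (r : 𝕜) • D := by
  have hr' : (r : 𝕜) ≠ 0 := by exact_mod_cast hr.ne'
  refine Set.mem_smul_set.2 ⟨((r : 𝕜)⁻¹ * a) • x + ((r : 𝕜)⁻¹ * b) • y, hD x hx y hy _ _ ?_, ?_⟩
  · rw [norm_mul, norm_mul, norm_inv, RCLike.norm_ofReal, abs_of_pos hr, ← mul_add,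
      inv_mul_le_iff₀ hr]
    simpa using h
  · rw [smul_add, smul_smul, smul_smul, mul_inv_cancel_left₀ hr', mul_inv_cancel_left₀ hr']

/-- `a (r D) + b (s D) ⊆ t D` for `|a| r + |b| s ≤ t`. -/
theorem IsDisk.comb_mem' {D : Set V} (hD : IsDisk 𝕜 D) {x y : V} {r s t : ℝ} (hr : 0 < r)
    (hs : 0 < s) (ht : 0 < t) (hx : x ∈ (r : 𝕜) • D) (hy : y ∈ (s : 𝕜) • D) {a b : 𝕜}
    (h : ‖a‖ * r + ‖b‖ * s ≤ t) : a • x + b • y ∈ (t : 𝕜) • D := by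
  obtain ⟨x, hx, rfl⟩ := hx
  obtain ⟨y, hy, rfl⟩ := hy
  simp only [smul_smul]
  refine hD.comb_mem hx hy ht ?_
  rwa [norm_mul, norm_mul, RCLike.norm_ofReal, RCLike.norm_ofReal, abs_of_pos hr, abs_of_pos hs]

theorem IsDisk.add_mem {D : Set V} (hD : IsDisk 𝕜 D) {x y : V} {r s : ℝ} (hr : 0 < r)
    (hs : 0 < s) (hx : x ∈ (r : 𝕜) • D) (hy : y ∈ (s : 𝕜) • D) :
    x + y ∈ ((r + s : ℝ) : 𝕜) • D := by
  have := hD.comb_mem' hr hs (add_pos hr hs) hx hy (a := 1) (b := 1) (by simp)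
  simpa using this

theorem IsDisk.sub_mem {D : Set V} (hD : IsDisk 𝕜 D) {x y : V} {r s : ℝ} (hr : 0 < r)
    (hs : 0 < s) (hx : x ∈ (r : 𝕜) • D) (hy : y ∈ (s : 𝕜) • D) :
    x - y ∈ ((r + s : ℝ) : 𝕜) • D := by
  have := hD.comb_mem' hr hs (add_pos hr hs) hx hy (a := 1) (b := -1) (by simp)
  simpa [sub_eq_add_neg] using this

theorem IsDisk.smul {D : Set V} (hD : IsDisk 𝕜 D) (c : 𝕜) : IsDisk 𝕜 (c • D) := by
  rintro _ ⟨x, hx, rfl⟩ _ ⟨y, hy, rfl⟩ a b hab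
  refine ⟨a • x + b • y, hD x hx y hy a b hab, ?_⟩
  simp only [smul_add]
  rw [smul_comm c a, smul_comm c b]

variable {W : Type*} [AddCommGroup W] [Module 𝕜 W]

theorem IsDisk.image {D : Set V} (hD : IsDisk 𝕜 D) (f : V →ₗ[𝕜] W) : IsDisk 𝕜 (f '' D) := by
  rintro _ ⟨x, hx, rfl⟩ _ ⟨y, hy, rfl⟩ a b hab
  exact ⟨a • x + b • y, hD x hx y hy a b hab, by simp⟩

theorem IsDisk.preimage {D : Set W} (hD : IsDisk 𝕜 D) (f : V →ₗ[𝕜] W) : IsDisk 𝕜 (f ⁻¹' D) := by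
  intro x hx y hy a b hab
  simpa using hD _ hx _ hy a b hab

theorem isDisk_diskHull (S : Set V) : IsDisk 𝕜 (diskHull 𝕜 S) :=
  fun x hx y hy a b hab D hD => hD.1 x (hx D hD) y (hy D hD) a b hab

theorem subset_diskHull (S : Set V) : S ⊆ diskHull 𝕜 S :=
  fun _ hx _ hD => hD.2 hx

theorem diskHull_subset {S D : Set V} (hD : IsDisk 𝕜 D) (h : S ⊆ D) : diskHull 𝕜 S ⊆ D :=
  fun _ hx => hx D ⟨hD, h⟩

theorem DiskTendsto.mono {D E : Set V} (h : D ⊆ E) {x : ℕ → V} {v : V}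
    (hx : DiskTendsto 𝕜 D x v) : DiskTendsto 𝕜 E x v := fun ε hε => by
  obtain ⟨N, hN⟩ := hx ε hε
  exact ⟨N, fun n hn => Set.smul_set_mono h (hN n hn)⟩

theorem DiskCauchy.mono {D E : Set V} (h : D ⊆ E) {x : ℕ → V}
    (hx : DiskCauchy 𝕜 D x) : DiskCauchy 𝕜 E x := fun ε hε => by
  obtain ⟨N, hN⟩ := hx ε hε
  exact ⟨N, fun m hm n hn => Set.smul_set_mono h (hN m hm n hn)⟩

theorem mem_smul_image {f : V →ₗ[𝕜] W} {D : Set V} {c : 𝕜} {x : V} (hx : x ∈ c • D) :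
    f x ∈ c • (f '' D) := by
  obtain ⟨d, hd, rfl⟩ := hx
  exact ⟨f d, ⟨d, hd, rfl⟩, by simp⟩

theorem DiskTendsto.map {D : Set V} (f : V →ₗ[𝕜] W) {x : ℕ → V} {v : V}
    (hx : DiskTendsto 𝕜 D x v) : DiskTendsto 𝕜 (f '' D) (fun n => f (x n)) (f v) := fun ε hε => by
  obtain ⟨N, hN⟩ := hx ε hε
  refine ⟨N, fun n hn => ?_⟩
  have := mem_smul_image (f := f) (hN n hn)
  simpa using this

theorem DiskCauchy.map {D : Set V} (f : V →ₗ[𝕜] W) {x : ℕ → V}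
    (hx : DiskCauchy 𝕜 D x) : DiskCauchy 𝕜 (f '' D) (fun n => f (x n)) := fun ε hε => by
  obtain ⟨N, hN⟩ := hx ε hε
  refine ⟨N, fun m hm n hn => ?_⟩
  have := mem_smul_image (f := f) (hN m hm n hn)
  simpa using this

theorem DiskTendsto.comb {D : Set V} (hD : IsDisk 𝕜 D) {x y : ℕ → V} {v w : V}
    (hx : DiskTendsto 𝕜 D x v) (hy : DiskTendsto 𝕜 D y w) (a b : 𝕜) :
    DiskTendsto 𝕜 D (fun n => a • x n + b • y n) (a • v + b • w) := fun ε hε => by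
  have hab : 0 < ‖a‖ + ‖b‖ + 1 := by positivity
  have hδ : 0 < ε / (‖a‖ + ‖b‖ + 1) := div_pos hε hab
  obtain ⟨N, hN⟩ := hx _ hδ
  obtain ⟨M, hM⟩ := hy _ hδ
  refine ⟨max N M, fun n hn => ?_⟩
  have := hD.comb_mem' hδ hδ hε (hN n (le_of_max_le_left hn)) (hM n (le_of_max_le_right hn))
    (a := a) (b := b) (by
      rw [← add_mul, mul_div_assoc', div_le_iff₀ hab]; nlinarith [norm_nonneg a, norm_nonneg b])
  convert this using 1
  simp only [smul_sub]; abel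

theorem DiskCauchy.comb {D : Set V} (hD : IsDisk 𝕜 D) {x y : ℕ → V}
    (hx : DiskCauchy 𝕜 D x) (hy : DiskCauchy 𝕜 D y) (a b : 𝕜) :
    DiskCauchy 𝕜 D (fun n => a • x n + b • y n) := fun ε hε => by
  have hab : 0 < ‖a‖ + ‖b‖ + 1 := by positivity
  have hδ : 0 < ε / (‖a‖ + ‖b‖ + 1) := div_pos hε hab
  obtain ⟨N, hN⟩ := hx _ hδ
  obtain ⟨M, hM⟩ := hy _ hδ
  refine ⟨max N M, fun m hm n hn => ?_⟩
  have := hD.comb_mem' hδ hδ hε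
    (hN m (le_of_max_le_left hm) n (le_of_max_le_left hn))
    (hM m (le_of_max_le_right hm) n (le_of_max_le_right hn))
    (a := a) (b := b) (by
      rw [← add_mul, mul_div_assoc', div_le_iff₀ hab]; nlinarith [norm_nonneg a, norm_nonneg b])
  convert this using 1
  simp only [smul_sub]; abel

/-- A Cauchy sequence with a convergent subsequence converges. -/
theorem DiskCauchy.tendsto_of_subseq {D : Set V} (hD : IsDisk 𝕜 D) {x : ℕ → V}
    (hx : DiskCauchy 𝕜 D x) {k : ℕ → ℕ} (hk : ∀ j, j ≤ k j) {v : V}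
    (hv : DiskTendsto 𝕜 D (fun j => x (k j)) v) : DiskTendsto 𝕜 D x v := fun ε hε => by
  obtain ⟨N, hN⟩ := hx (ε / 2) (half_pos hε)
  obtain ⟨M, hM⟩ := hv (ε / 2) (half_pos hε)
  refine ⟨N, fun n hn => ?_⟩
  have h1 := hN n hn (k (max N M)) ((le_max_left N M).trans (hk _))
  have h2 := hM (max N M) (le_max_right N M)
  have := hD.add_mem (half_pos hε) (half_pos hε) h1 h2
  simpa using this

/-- If a sequence converges with respect to `D` and its terms are eventually in `D`, then its limit
is in `2 D`. -/
theorem DiskTendsto.mem_two_smul {D : Set V} (hD : IsDisk 𝕜 D) {x : ℕ → V} {v : V}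
    (hx : DiskTendsto 𝕜 D x v) (h : ∃ N, ∀ n ≥ N, x n ∈ D) : v ∈ ((2 : ℝ) : 𝕜) • D := by
  obtain ⟨N, hN⟩ := hx 1 one_pos
  obtain ⟨M, hM⟩ := h
  have h1 := hN (max N M) (le_max_left _ _)
  have h2 : x (max N M) ∈ ((1 : ℝ) : 𝕜) • D := by simpa using hM _ (le_max_right N M)
  have := hD.sub_mem one_pos one_pos h2 h1
  norm_num at this ⊢
  exact this

/-- A sequence whose consecutive differences lie in `2⁻ⁿ D` is Cauchy. -/
theorem diskCauchy_of_geometric {D : Set V} (hD : IsDisk 𝕜 D) {x : ℕ → V}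
    (h : ∀ n, x (n + 1) - x n ∈ (((1 / 2 : ℝ) ^ n : ℝ) : 𝕜) • D) : DiskCauchy 𝕜 D x := by
  have h0 : (0 : V) ∈ D := by
    obtain ⟨d, hd, -⟩ := h 0
    exact hD.zero_mem hd
  have key : ∀ N k : ℕ, ∃ d ∈ D,
      x (N + k) - x N = ((2 * (1 / 2 : ℝ) ^ N - 2 * (1 / 2 : ℝ) ^ (N + k) : ℝ) : 𝕜) • d := by
    intro N k
    induction k with
    | zero => exact ⟨0, h0, by simp⟩
    | succ k ih =>
      obtain ⟨d, hd, hd'⟩ := ih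
      obtain ⟨e, he, he'⟩ := h (N + k)
      have hp : 0 < (1 / 2 : ℝ) ^ (N + k) := by positivity
      have hle : (1 / 2 : ℝ) ^ (N + k) ≤ (1 / 2 : ℝ) ^ N :=
        pow_le_pow_of_le_one (by norm_num) (by norm_num) (by omega)
      have hs : (1 / 2 : ℝ) ^ (N + k + 1) = (1 / 2 : ℝ) ^ (N + k) / 2 := by
        rw [pow_succ]; ring
      have ht : 0 < 2 * (1 / 2 : ℝ) ^ N - 2 * (1 / 2 : ℝ) ^ (N + (k + 1)) := by
        rw [← add_assoc, hs]; linarith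
      have := hD.comb_mem hd he (a := ((2 * (1 / 2 : ℝ) ^ N - 2 * (1 / 2 : ℝ) ^ (N + k) : ℝ) : 𝕜))
        (b := (((1 / 2 : ℝ) ^ (N + k) : ℝ) : 𝕜)) ht (by
          rw [RCLike.norm_ofReal, RCLike.norm_ofReal, abs_of_nonneg (by linarith), abs_of_pos hp,
            ← add_assoc, hs]
          linarith)
      obtain ⟨f, hf, hf'⟩ := this
      refine ⟨f, hf, ?_⟩
      simp only at hf' he'
      rw [hf', ← hd', he', ← add_assoc]
      abel
  intro ε hε
  obtain ⟨N, hN⟩ := exists_pow_lt_of_lt_one (show 0 < ε / 4 by positivity)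
    (show (1 / 2 : ℝ) < 1 by norm_num)
  have hp : 0 < (1 / 2 : ℝ) ^ N := by positivity
  have key2 : ∀ n ≥ N, x n - x N ∈ ((ε / 2 : ℝ) : 𝕜) • D := by
    intro n hn
    obtain ⟨k, rfl⟩ := Nat.exists_eq_add_of_le hn
    obtain ⟨d, hd, hd'⟩ := key N k
    rw [hd']
    have hq : 0 < (1 / 2 : ℝ) ^ (N + k) := by positivity
    have hle : (1 / 2 : ℝ) ^ (N + k) ≤ (1 / 2 : ℝ) ^ N :=
      pow_le_pow_of_le_one (by norm_num) (by norm_num) (by omega)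
    refine hD.smul_mem_smul hd (half_pos hε) ?_
    rw [RCLike.norm_ofReal, abs_of_nonneg (by linarith)]
    linarith
  refine ⟨N, fun m hm n hn => ?_⟩
  have := hD.sub_mem (half_pos hε) (half_pos hε) (key2 m hm) (key2 n hn)
  simpa using this

/-- A Cauchy sequence has a subsequence whose consecutive differences lie in `2⁻ⁿ D`. -/
theorem DiskCauchy.exists_subseq {D : Set V} {x : ℕ → V} (hx : DiskCauchy 𝕜 D x) :
    ∃ k : ℕ → ℕ, (∀ j, j ≤ k j) ∧
      ∀ j, x (k (j + 1)) - x (k j) ∈ (((1 / 2 : ℝ) ^ j : ℝ) : 𝕜) • D := by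
  choose N hN using fun j : ℕ => hx ((1 / 2 : ℝ) ^ j) (by positivity)
  refine ⟨fun j => j + ∑ i ∈ Finset.range (j + 1), N i, fun j => Nat.le_add_right _ _, fun j => ?_⟩
  have h1 : N j ≤ ∑ i ∈ Finset.range (j + 1), N i :=
    Finset.single_le_sum (fun _ _ => Nat.zero_le _) (Finset.self_mem_range_succ j)
  have h2 : N j ≤ ∑ i ∈ Finset.range (j + 1 + 1), N i :=
    Finset.single_le_sum (fun _ _ => Nat.zero_le _) (Finset.mem_range.2 (by omega))
  exact hN j _ (by dsimp only; omega) _ (by dsimp only; omega)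

end Disks

/-! ## Convex bornological vector spaces -/

/-- A convex bornological `𝕜`-vector space: addition and scalar multiplication are bounded maps
and every bounded set is contained in a bounded disk. -/
structure BornVec (𝕜 : Type) [RCLike 𝕜] : Type (u + 1) where
  carrier : Type u
  [addCommGroup : AddCommGroup carrier]
  [module : Module 𝕜 carrier]
  [bornology : Bornology carrier]
  isBounded_add : ∀ {S T : Set carrier}, IsBounded S → IsBounded T → IsBounded (S + T)
  isBounded_smul : ∀ {Λ : Set 𝕜} {S : Set carrier}, IsBounded Λ → IsBounded S → IsBounded (Λ • S)
  exists_disk : ∀ {S : Set carrier}, IsBounded S → ∃ D, IsBounded D ∧ IsDisk 𝕜 D ∧ S ⊆ D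

attribute [instance] BornVec.addCommGroup BornVec.module BornVec.bornology

namespace BornVec

variable {𝕜 : Type} [RCLike 𝕜]

instance : CoeSort (BornVec.{u} 𝕜) (Type u) := ⟨BornVec.carrier⟩

variable {U V W : BornVec.{u} 𝕜}

/-- Mackey convergence of a sequence: convergence with respect to some bounded disk. (Such a disk
can be enlarged so that its span contains the limit.) -/
def MackeyTendsto (x : ℕ → V) (v : V) : Prop :=
  ∃ D : Set V, IsBounded D ∧ IsDisk 𝕜 D ∧ DiskTendsto 𝕜 D x v

/-- Mackey-Cauchy sequences. -/
def MackeyCauchy (x : ℕ → V) : Prop :=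
  ∃ D : Set V, IsBounded D ∧ IsDisk 𝕜 D ∧ DiskCauchy 𝕜 D x

/-- A convex bornological vector space is complete if every bounded set is contained in a bounded
completant disk. -/
def IsComplete (V : BornVec.{u} 𝕜) : Prop :=
  ∀ ⦃S : Set V⦄, IsBounded S → ∃ D, IsBounded D ∧ IsCompletant 𝕜 D ∧ S ⊆ D

/-- The vector space of bounded linear maps. -/
def boundedMaps (V W : BornVec.{u} 𝕜) : Submodule 𝕜 (V →ₗ[𝕜] W) where
  carrier := {f | ∀ S : Set V, IsBounded S → IsBounded (f '' S)}
  zero_mem' := fun S _ => (isBounded_singleton (x := (0 : W))).subset (by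
    rintro _ ⟨x, -, rfl⟩; simp)
  add_mem' := fun {f g} hf hg S hS => (W.isBounded_add (hf S hS) (hg S hS)).subset (by
    rintro _ ⟨x, hx, rfl⟩
    exact Set.add_mem_add ⟨x, hx, rfl⟩ ⟨x, hx, rfl⟩)
  smul_mem' := fun c f hf S hS =>
    (W.isBounded_smul (isBounded_singleton (x := c)) (hf S hS)).subset (by
      rintro _ ⟨x, hx, rfl⟩
      exact Set.smul_mem_smul rfl ⟨x, hx, rfl⟩)

theorem isBounded_const_smul (c : 𝕜) {S : Set V} (hS : IsBounded S) : IsBounded (c • S) := by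
  have := V.isBounded_smul (isBounded_singleton (x := c)) hS
  rwa [Set.singleton_smul] at this

/-- Two bounded sets are contained in a common bounded disk. -/
theorem exists_disk₂ {S T : Set V} (hS : IsBounded S) (hT : IsBounded T) :
    ∃ D, IsBounded D ∧ IsDisk 𝕜 D ∧ S ⊆ D ∧ T ⊆ D := by
  obtain ⟨D, h1, h2, h3⟩ := V.exists_disk (hS.union hT)
  exact ⟨D, h1, h2, Set.subset_union_left.trans h3, Set.subset_union_right.trans h3⟩

/-- The convex bornological vector space whose bounded sets are the subsets of the members of a
directed, scalable family of disks that covers the vector space. -/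
def ofDisks (V : Type u) [AddCommGroup V] [Module 𝕜 V] (𝓓 : Set (Set V))
    (disk : ∀ D ∈ 𝓓, IsDisk 𝕜 D)
    (directed : ∀ D ∈ 𝓓, ∀ E ∈ 𝓓, ∃ F ∈ 𝓓, D ∪ E ⊆ F)
    (scale : ∀ D ∈ 𝓓, ∀ r : ℝ, 0 < r → ∃ E ∈ 𝓓, (r : 𝕜) • D ⊆ E)
    (cover : ∀ v : V, ∃ D ∈ 𝓓, v ∈ D) : BornVec.{u} 𝕜 :=
  letI : Bornology V := Bornology.ofBounded {S | ∃ D ∈ 𝓓, S ⊆ D}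
    (by obtain ⟨D, hD, -⟩ := cover 0; exact ⟨D, hD, Set.empty_subset _⟩)
    (fun _ ⟨D, hD, h⟩ _ hs => ⟨D, hD, hs.trans h⟩)
    (fun _ ⟨D, hD, h⟩ _ ⟨E, hE, h'⟩ => by
      obtain ⟨F, hF, hF'⟩ := directed D hD E hE
      exact ⟨F, hF, (Set.union_subset_union h h').trans hF'⟩)
    (fun v => by
      obtain ⟨D, hD, h⟩ := cover v
      exact ⟨D, hD, Set.singleton_subset_iff.2 h⟩)
  have key : ∀ S : Set V, IsBounded S ↔ ∃ D ∈ 𝓓, S ⊆ D := fun S =>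
    Bornology.isBounded_ofBounded_iff _
  { carrier := V
    isBounded_add := by
      intro S T hS hT
      rw [key] at *
      obtain ⟨D, hD, hS⟩ := hS
      obtain ⟨E, hE, hT⟩ := hT
      obtain ⟨F, hF, hF'⟩ := directed D hD E hE
      obtain ⟨G, hG, hG'⟩ := scale F hF 2 two_pos
      refine ⟨G, hG, Set.Subset.trans ?_ hG'⟩
      rintro _ ⟨s, hs, t, ht, rfl⟩
      have := (disk F hF).comb_mem (hF' (Or.inl (hS hs))) (hF' (Or.inr (hT ht)))
        (a := 1) (b := 1) two_pos (by norm_num)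
      simpa using this
    isBounded_smul := by
      intro Λ S hΛ hS
      rw [key] at *
      obtain ⟨D, hD, hS⟩ := hS
      obtain ⟨r, hr, hΛ⟩ := hΛ.exists_pos_norm_le
      obtain ⟨E, hE, hE'⟩ := scale D hD r hr
      refine ⟨E, hE, Set.Subset.trans ?_ hE'⟩
      rintro _ ⟨c, hc, s, hs, rfl⟩
      exact (disk D hD).smul_mem_smul (hS hs) hr (hΛ c hc)
    exists_disk := by
      intro S hS
      obtain ⟨D, hD, hS⟩ := (key _).1 hS
      exact ⟨D, (key _).2 ⟨D, hD, subset_rfl⟩, disk D hD, hS⟩ }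

theorem isBounded_ofDisks {V : Type u} [AddCommGroup V] [Module 𝕜 V] {𝓓 : Set (Set V)}
    {h1 : ∀ D ∈ 𝓓, IsDisk 𝕜 D} {h2 : ∀ D ∈ 𝓓, ∀ E ∈ 𝓓, ∃ F ∈ 𝓓, D ∪ E ⊆ F}
    {h3 : ∀ D ∈ 𝓓, ∀ r : ℝ, 0 < r → ∃ E ∈ 𝓓, (r : 𝕜) • D ⊆ E} {h4 : ∀ v : V, ∃ D ∈ 𝓓, v ∈ D}
    {S : Set V} :
    IsBounded (α := ofDisks V 𝓓 h1 h2 h3 h4) S ↔ ∃ D ∈ 𝓓, S ⊆ D :=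
  Bornology.isBounded_ofBounded_iff (α := V) {S | ∃ D ∈ 𝓓, S ⊆ D}
    (sUnion_univ := fun v => by
      obtain ⟨D, hD, h⟩ := h4 v
      exact ⟨D, hD, Set.singleton_subset_iff.2 h⟩)

/-! ### The inner hom -/

/-- The inner hom: the bounded linear maps, where a set `F` of maps is bounded if `F(A)` is bounded
for every bounded set `A`. -/
def ihom (V W : BornVec.{u} 𝕜) : BornVec.{u} 𝕜 :=
  letI : Bornology (boundedMaps V W) := Bornology.ofBounded
    {F | ∀ A : Set V, IsBounded A → IsBounded {w : W | ∃ f ∈ F, ∃ a ∈ A, f.1 a = w}}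
    (fun A _ => isBounded_empty.subset (by rintro w ⟨f, hf, -⟩; exact hf.elim))
    (fun F hF G hG A hA => (hF A hA).subset (by
      rintro w ⟨f, hf, a, ha, rfl⟩; exact ⟨f, hG hf, a, ha, rfl⟩))
    (fun F hF G hG A hA => ((hF A hA).union (hG A hA)).subset (by
      rintro w ⟨f, hf | hf, a, ha, rfl⟩
      · exact Or.inl ⟨f, hf, a, ha, rfl⟩
      · exact Or.inr ⟨f, hf, a, ha, rfl⟩))
    (fun f A hA => (f.2 A hA).subset (by
      rintro w ⟨g, hg, a, ha, rfl⟩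
      obtain rfl : g = f := hg
      exact ⟨a, ha, rfl⟩))
  have key : ∀ F : Set (boundedMaps V W), IsBounded F ↔
      ∀ A : Set V, IsBounded A → IsBounded {w : W | ∃ f ∈ F, ∃ a ∈ A, f.1 a = w} := fun F =>
    Bornology.isBounded_ofBounded_iff _
  { carrier := boundedMaps V W
    isBounded_add := by
      intro F G hF hG
      rw [key] at *
      refine fun A hA => (W.isBounded_add (hF A hA) (hG A hA)).subset ?_
      rintro w ⟨_, ⟨f, hf, g, hg, rfl⟩, a, ha, rfl⟩
      exact Set.add_mem_add ⟨f, hf, a, ha, rfl⟩ ⟨g, hg, a, ha, rfl⟩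
    isBounded_smul := by
      intro Λ F hΛ hF
      rw [key] at *
      refine fun A hA => (W.isBounded_smul hΛ (hF A hA)).subset ?_
      rintro w ⟨_, ⟨c, hc, f, hf, rfl⟩, a, ha, rfl⟩
      exact Set.smul_mem_smul hc ⟨f, hf, a, ha, rfl⟩
    exists_disk := by
      intro F hF
      rw [key] at hF
      refine ⟨diskHull 𝕜 F, (key _).2 fun A hA => ?_, isDisk_diskHull F, subset_diskHull F⟩
      obtain ⟨D, hD, hD', h⟩ := W.exists_disk (hF A hA)
      refine hD.subset ?_
      rintro w ⟨f, hf, a, ha, rfl⟩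
      have hdisk : IsDisk 𝕜 {g : boundedMaps V W | g.1 a ∈ D} :=
        hD'.preimage ((LinearMap.applyₗ a).comp (boundedMaps V W).subtype)
      exact diskHull_subset hdisk (fun g hg => h ⟨g, hg, a, ha, rfl⟩) hf }

/-! ### Closed subspaces and quotients -/

/-- A subspace is (Mackey) closed if it contains all Mackey limits of its sequences. -/
def IsMackeyClosed (P : Submodule 𝕜 V) : Prop :=
  ∀ (x : ℕ → V) (v : V), (∀ n, x n ∈ P) → MackeyTendsto x v → v ∈ P

/-- The closure of a subspace: the smallest closed subspace that contains it. -/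
def closure (P : Submodule 𝕜 V) : Submodule 𝕜 V :=
  sInf {Q | IsMackeyClosed Q ∧ P ≤ Q}

theorem isMackeyClosed_closure (P : Submodule 𝕜 V) : IsMackeyClosed (closure P) := by
  intro x v hx hv
  refine (Submodule.mem_sInf).2 fun Q hQ => hQ.1 x v (fun n => ?_) hv
  exact (Submodule.mem_sInf).1 (hx n) Q hQ

theorem le_closure (P : Submodule 𝕜 V) : P ≤ closure P :=
  le_sInf fun _ hQ => hQ.2

theorem closure_le {P Q : Submodule 𝕜 V} (hQ : IsMackeyClosed Q) (h : P ≤ Q) : closure P ≤ Q :=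
  sInf_le ⟨hQ, h⟩

/-- The quotient of a convex bornological vector space by a subspace; the bounded sets are the
images of the bounded sets. -/
def quot (V : BornVec.{u} 𝕜) (P : Submodule 𝕜 V) : BornVec.{u} 𝕜 :=
  ofDisks (V ⧸ P) {E | ∃ D : Set V, IsBounded D ∧ IsDisk 𝕜 D ∧ P.mkQ '' D = E}
    (by rintro _ ⟨D, -, hD, rfl⟩; exact hD.image _)
    (by
      rintro _ ⟨D, hD, -, rfl⟩ _ ⟨E, hE, -, rfl⟩
      obtain ⟨F, hF, hF', h1, h2⟩ := exists_disk₂ hD hE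
      exact ⟨_, ⟨F, hF, hF', rfl⟩, Set.union_subset (Set.image_mono h1) (Set.image_mono h2)⟩)
    (by
      rintro _ ⟨D, hD, hD', rfl⟩ r -
      refine ⟨_, ⟨(r : 𝕜) • D, isBounded_const_smul _ hD, hD'.smul _, rfl⟩, ?_⟩
      rintro _ ⟨_, ⟨d, hd, rfl⟩, rfl⟩
      exact ⟨(r : 𝕜) • d, Set.smul_mem_smul_set hd, by simp⟩)
    (by
      intro v
      obtain ⟨w, rfl⟩ := P.mkQ_surjective v
      obtain ⟨D, hD, hD', h⟩ := V.exists_disk (isBounded_singleton (x := w))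
      exact ⟨_, ⟨D, hD, hD', rfl⟩, ⟨w, h rfl, rfl⟩⟩)

theorem isBounded_quot {P : Submodule 𝕜 V} {S : Set (V.quot P)} :
    IsBounded S ↔ ∃ D : Set V, IsBounded D ∧ IsDisk 𝕜 D ∧ S ⊆ P.mkQ '' D := by
  refine (isBounded_ofDisks (V := V ⧸ P)).trans ⟨?_, ?_⟩
  · rintro ⟨_, ⟨D, hD, hD', rfl⟩, h⟩; exact ⟨D, hD, hD', h⟩
  · rintro ⟨D, hD, hD', h⟩; exact ⟨_, ⟨D, hD, hD', rfl⟩, h⟩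

/-- The quotient map. -/
def quotMk (P : Submodule 𝕜 V) : boundedMaps V (V.quot P) :=
  ⟨P.mkQ, fun S hS => by
    obtain ⟨D, hD, hD', h⟩ := V.exists_disk hS
    exact isBounded_quot.2 ⟨D, hD, hD', Set.image_mono h⟩⟩

/-- Bounded linear maps that vanish on `P` descend to the quotient. -/
def quotDesc (P : Submodule 𝕜 V) (f : boundedMaps V W) (h : P ≤ LinearMap.ker f.1) :
    boundedMaps (V.quot P) W :=
  ⟨P.liftQ f.1 h, fun S hS => by
    obtain ⟨D, hD, -, hSD⟩ := isBounded_quot.1 hS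
    refine (f.2 D hD).subset ?_
    rintro _ ⟨s, hs, rfl⟩
    obtain ⟨d, hd, rfl⟩ := hSD hs
    exact ⟨d, hd, rfl⟩⟩

/-- The quotient by a closed subspace is complete, provided that every bounded set is contained in
a bounded disk in which all Cauchy sequences converge. -/
theorem isComplete_quot (P : Submodule 𝕜 V) (hP : IsMackeyClosed P)
    (hV : ∀ S : Set V, IsBounded S → ∃ D, IsBounded D ∧ IsDisk 𝕜 D ∧ S ⊆ D ∧
      ∀ x : ℕ → V, DiskCauchy 𝕜 D x → ∃ v, DiskTendsto 𝕜 D x v) :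
    (V.quot P).IsComplete := by
  intro S hS
  obtain ⟨D', hD', -, hSD⟩ := isBounded_quot.1 hS
  obtain ⟨D, hD, hdisk, hDD, hlim⟩ := hV D' hD'
  have hE : IsDisk 𝕜 (P.mkQ '' D) := hdisk.image _
  refine ⟨P.mkQ '' D, isBounded_quot.2 ⟨D, hD, hdisk, subset_rfl⟩, ⟨hE, ?_, ?_⟩,
    hSD.trans (Set.image_mono hDD)⟩
  · intro v hv
    obtain ⟨w, rfl⟩ := P.mkQ_surjective v
    have hex : ∀ ε : ℝ, 0 < ε → ∃ p ∈ P, w - p ∈ (ε : 𝕜) • D := by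
      intro ε hε
      obtain ⟨_, ⟨d, hd, rfl⟩, h⟩ := hv ε hε
      refine ⟨w - (ε : 𝕜) • d, ?_, by simpa using Set.smul_mem_smul_set hd⟩
      rw [← Submodule.ker_mkQ P, LinearMap.mem_ker, map_sub, map_smul, sub_eq_zero]
      exact h.symm
    choose p hp hp' using fun n : ℕ => hex (1 / (n + 1 : ℝ)) (by positivity)
    have hw : w ∈ P := by
      refine hP p w hp ⟨D, hD, hdisk, fun ε hε => ?_⟩
      obtain ⟨N, hN⟩ := exists_nat_one_div_lt hε
      refine ⟨N, fun n hn => ?_⟩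
      have h1 : p n - w ∈ ((1 / (n + 1 : ℝ) : ℝ) : 𝕜) • D := by
        obtain ⟨d, hd, h⟩ := hp' n
        refine ⟨(-1 : 𝕜) • d, hdisk.smul_mem hd (by simp), ?_⟩
        rw [← neg_sub w, ← h]
        simp only [neg_smul, one_smul, smul_neg]
      refine hdisk.mono_smul (by positivity) (le_trans ?_ hN.le) h1
      exact one_div_le_one_div_of_le (by positivity) (by exact_mod_cast Nat.succ_le_succ hn)
    exact (Submodule.Quotient.mk_eq_zero P).2 hw
  · intro x hx
    obtain ⟨k, hk, hk'⟩ := hx.exists_subseq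
    have hstep : ∀ j, ∃ d : V, d ∈ (((1 / 2 : ℝ) ^ j : ℝ) : 𝕜) • D ∧
        P.mkQ d = x (k (j + 1)) - x (k j) := by
      intro j
      obtain ⟨_, ⟨d, hd, rfl⟩, h⟩ := hk' j
      exact ⟨_, Set.smul_mem_smul_set hd, by rw [map_smul]; exact h⟩
    choose d hd hd' using hstep
    obtain ⟨w0, hw0⟩ := P.mkQ_surjective (x (k 0))
    let w : ℕ → V := fun j => w0 + ∑ i ∈ Finset.range j, d i
    have hw : ∀ j, P.mkQ (w j) = x (k j) := by
      intro j
      induction j with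
      | zero => simpa [w] using hw0
      | succ j ih =>
        have : w (j + 1) = w j + d j := by simp [w, Finset.sum_range_succ, add_assoc]
        rw [this, map_add, ih, hd']
        abel
    have hwC : DiskCauchy 𝕜 D w := diskCauchy_of_geometric hdisk fun n => by
      simpa [w, Finset.sum_range_succ] using hd n
    obtain ⟨v, hv⟩ := hlim w hwC
    refine ⟨P.mkQ v, hx.tendsto_of_subseq hE hk ?_⟩
    have := hv.map P.mkQ
    simp only [hw] at this
    exact this

/-! ### Limits in complete spaces -/

theorem IsComplete.tendsto_unique (hW : W.IsComplete) {x : ℕ → W} {v w : W}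
    (hv : MackeyTendsto x v) (hw : MackeyTendsto x w) : v = w := by
  obtain ⟨D, hD, -, hv⟩ := hv
  obtain ⟨E, hE, -, hw⟩ := hw
  obtain ⟨F, -, hF, hDE⟩ := hW (hD.union hE)
  replace hv := hv.mono (Set.subset_union_left.trans hDE)
  replace hw := hw.mono (Set.subset_union_right.trans hDE)
  refine sub_eq_zero.1 (hF.norming _ fun ε hε => ?_)
  obtain ⟨N, hN⟩ := hv (ε / 2) (half_pos hε)
  obtain ⟨M, hM⟩ := hw (ε / 2) (half_pos hε)
  have := hF.disk.sub_mem (half_pos hε) (half_pos hε) (hM _ (le_max_right N M))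
    (hN _ (le_max_left N M))
  simpa using this

theorem MackeyTendsto.map (f : boundedMaps V W) {x : ℕ → V} {v : V} (h : MackeyTendsto x v) :
    MackeyTendsto (fun n => f.1 (x n)) (f.1 v) := by
  obtain ⟨D, hD, hD', h⟩ := h
  exact ⟨f.1 '' D, f.2 D hD, hD'.image _, h.map f.1⟩

theorem MackeyTendsto.comb {x y : ℕ → V} {v w : V} (hx : MackeyTendsto x v)
    (hy : MackeyTendsto y w) (a b : 𝕜) :
    MackeyTendsto (fun n => a • x n + b • y n) (a • v + b • w) := by
  obtain ⟨D, hD, -, hx⟩ := hx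
  obtain ⟨E, hE, -, hy⟩ := hy
  obtain ⟨F, hF, hF', h1, h2⟩ := exists_disk₂ hD hE
  exact ⟨F, hF, hF', (hx.mono h1).comb hF' (hy.mono h2) a b⟩

theorem isMackeyClosed_ker (hW : W.IsComplete) (f : boundedMaps V W) :
    IsMackeyClosed (LinearMap.ker f.1) := by
  intro x v hx hv
  have h1 := hv.map f
  have h2 : MackeyTendsto (fun n => f.1 (x n)) (0 : W) := by
    obtain ⟨D, hD, hD', h⟩ := W.exists_disk (isBounded_singleton (x := (0 : W)))
    refine ⟨D, hD, hD', fun ε _ => ⟨0, fun n _ => ⟨0, h rfl, ?_⟩⟩⟩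
    have : f.1 (x n) = 0 := hx n
    simp [this]
  exact hW.tendsto_unique h1 h2

/-! ### Completion

The completion is obtained by formally adding the limits of Mackey-Cauchy sequences and then
dividing by the closure of `0`. Its universal property is proved below. -/

/-- The vector space of Mackey-Cauchy sequences. -/
def cauchySeq (V : BornVec.{u} 𝕜) : Submodule 𝕜 (ℕ → V) where
  carrier := {x | MackeyCauchy x}
  zero_mem' := by
    obtain ⟨D, hD, hD', h⟩ := V.exists_disk (isBounded_singleton (x := (0 : V)))
    exact ⟨D, hD, hD', fun ε _ => ⟨0, fun m _ n _ => ⟨0, h rfl, by simp⟩⟩⟩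
  add_mem' := by
    rintro x y ⟨D, hD, -, hx⟩ ⟨E, hE, -, hy⟩
    obtain ⟨F, hF, hF', h1, h2⟩ := exists_disk₂ hD hE
    have := (hx.mono h1).comb hF' (hy.mono h2) 1 1
    simp only [one_smul] at this
    exact ⟨F, hF, hF', this⟩
  smul_mem' := by
    rintro c x ⟨D, hD, hD', hx⟩
    have := hx.comb hD' hx c 0
    simp only [zero_smul, add_zero] at this
    exact ⟨D, hD, hD', this⟩

/-- The sequences that are Cauchy with respect to `D` and eventually lie in `D`. -/
def seqDisk (D : Set V) : Set V.cauchySeq :=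
  {x | DiskCauchy 𝕜 D x.1 ∧ ∃ N, ∀ n ≥ N, x.1 n ∈ D}

theorem isDisk_seqDisk {D : Set V} (hD : IsDisk 𝕜 D) : IsDisk 𝕜 (seqDisk D) := by
  rintro x ⟨hx, N, hN⟩ y ⟨hy, M, hM⟩ a b hab
  exact ⟨hx.comb hD hy a b, max N M, fun n hn =>
    hD _ (hN n (le_of_max_le_left hn)) _ (hM n (le_of_max_le_right hn)) a b hab⟩

theorem seqDisk_mono {D E : Set V} (h : D ⊆ E) : seqDisk D ⊆ seqDisk E :=
  fun _ ⟨hx, N, hN⟩ => ⟨hx.mono h, N, fun n hn => h (hN n hn)⟩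

/-- The space of Mackey-Cauchy sequences, with the bornology generated by the sets `seqDisk D` for
the bounded disks `D`. -/
def seqSpace (V : BornVec.{u} 𝕜) : BornVec.{u} 𝕜 :=
  ofDisks V.cauchySeq {E | ∃ D : Set V, IsBounded D ∧ IsDisk 𝕜 D ∧ seqDisk D = E}
    (by rintro _ ⟨D, -, hD, rfl⟩; exact isDisk_seqDisk hD)
    (by
      rintro _ ⟨D, hD, -, rfl⟩ _ ⟨E, hE, -, rfl⟩
      obtain ⟨F, hF, hF', h1, h2⟩ := exists_disk₂ hD hE
      exact ⟨_, ⟨F, hF, hF', rfl⟩, Set.union_subset (seqDisk_mono h1) (seqDisk_mono h2)⟩)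
    (by
      rintro _ ⟨D, hD, hD', rfl⟩ r -
      obtain ⟨F, hF, hF', h1, h2⟩ := exists_disk₂ hD (isBounded_const_smul (r : 𝕜) hD)
      refine ⟨_, ⟨F, hF, hF', rfl⟩, ?_⟩
      rintro _ ⟨x, ⟨hx, N, hN⟩, rfl⟩
      have := (hx.mono h1).comb hF' (hx.mono h1) (r : 𝕜) 0
      simp only [zero_smul, add_zero] at this
      exact ⟨this, N, fun n hn => h2 (Set.smul_mem_smul_set (hN n hn))⟩)
    (by
      rintro ⟨x, D, hD, -, hx⟩
      obtain ⟨N, hN⟩ := hx 1 one_pos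
      obtain ⟨F, hF, hF', h1, h2⟩ := exists_disk₂ hD (isBounded_singleton (x := x N))
      obtain ⟨G, hG, hG', h3, h4⟩ := exists_disk₂ hF (isBounded_const_smul ((2 : ℝ) : 𝕜) hF)
      refine ⟨_, ⟨G, hG, hG', rfl⟩, hx.mono (h1.trans h3), N, fun n hn => h4 ?_⟩
      have e1 : x n - x N ∈ ((1 : ℝ) : 𝕜) • F := Set.smul_set_mono h1 (hN n hn N le_rfl)
      have e2 : x N ∈ ((1 : ℝ) : 𝕜) • F := by simpa using h2 rfl
      have := hF'.add_mem one_pos one_pos e1 e2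
      norm_num at this ⊢
      exact this)

theorem isBounded_seqSpace {S : Set V.seqSpace} :
    IsBounded S ↔ ∃ D : Set V, IsBounded D ∧ IsDisk 𝕜 D ∧ S ⊆ seqDisk D := by
  refine (isBounded_ofDisks (V := V.cauchySeq)).trans ⟨?_, ?_⟩
  · rintro ⟨_, ⟨D, hD, hD', rfl⟩, h⟩; exact ⟨D, hD, hD', h⟩
  · rintro ⟨D, hD, hD', h⟩; exact ⟨_, ⟨D, hD, hD', rfl⟩, h⟩

/-- In the space of Mackey-Cauchy sequences, Cauchy sequences have limits. -/
theorem seqSpace_lim {D : Set V} (hD : IsDisk 𝕜 D) (x : ℕ → V.cauchySeq)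
    (hx : DiskCauchy 𝕜 (seqDisk D) x) (hDb : IsBounded D) :
    ∃ y : V.cauchySeq, DiskTendsto 𝕜 (seqDisk D) x y := by
  have hSD := isDisk_seqDisk (V := V) hD
  -- Unpack membership in a multiple of `seqDisk D`.
  have unpack : ∀ {c : ℝ} {z : V.cauchySeq}, z ∈ (c : 𝕜) • seqDisk D →
      DiskCauchy 𝕜 D z.1 ∧ ∃ N, ∀ n ≥ N, z.1 n ∈ (c : 𝕜) • D := by
    rintro c _ ⟨z, ⟨hz, N, hN⟩, rfl⟩
    have := hz.comb hD hz (c : 𝕜) 0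
    simp only [zero_smul, add_zero] at this
    exact ⟨this, N, fun n hn => Set.smul_mem_smul_set (hN n hn)⟩
  have pack : ∀ {c : ℝ} {z : V.cauchySeq}, 0 < c → DiskCauchy 𝕜 D z.1 →
      (∃ N, ∀ n ≥ N, z.1 n ∈ (c : 𝕜) • D) → z ∈ (c : 𝕜) • seqDisk D := by
    rintro c z hc hz ⟨N, hN⟩
    have hc' : (c : 𝕜) ≠ 0 := by exact_mod_cast hc.ne'
    refine (Set.mem_smul_set_iff_inv_smul_mem₀ hc' _ _).2 ⟨?_, N, fun n hn => ?_⟩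
    · have := hz.comb hD hz (c : 𝕜)⁻¹ 0
      simp only [zero_smul, add_zero] at this
      exact this
    · exact (Set.mem_smul_set_iff_inv_smul_mem₀ hc' _ _).1 (hN n hn)
  obtain ⟨K, hK⟩ := hx 1 one_pos
  -- The differences `z k = x (K + k) - x K` are Cauchy with respect to `D`.
  let z : ℕ → V.cauchySeq := fun k => x (K + k) - x K
  have hz : ∀ k, DiskCauchy 𝕜 D (z k).1 := fun k =>
    (unpack (hK (K + k) (Nat.le_add_right _ _) K le_rfl)).1
  have hzx : ∀ k l, z k - z l = x (K + k) - x (K + l) := fun k l => by simp [z]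
  choose n hn using fun k : ℕ => hz k (1 / (k + 1 : ℝ)) (by positivity)
  let y : ℕ → V := fun k => (z k).1 (n k)
  have hsub : ∀ ε : ℝ, 0 < ε → ∃ N, ∀ k ≥ N, ∀ l ≥ N, z k - z l ∈ (ε : 𝕜) • seqDisk D := by
    intro ε hε
    obtain ⟨N, hN⟩ := hx ε hε
    refine ⟨N, fun k hk l hl => ?_⟩
    rw [hzx]
    exact hN _ (by omega) _ (by omega)
  have small : ∀ ε : ℝ, 0 < ε → ∃ N : ℕ, ∀ k ≥ N, ∀ i ≥ n k, (z k).1 i - y k ∈ (ε : 𝕜) • D := by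
    intro ε hε
    obtain ⟨N, hN⟩ := exists_nat_one_div_lt hε
    refine ⟨N, fun k hk i hi => ?_⟩
    refine hD.mono_smul (by positivity) (le_trans ?_ hN.le) (hn k i hi (n k) le_rfl)
    exact one_div_le_one_div_of_le (by positivity) (by exact_mod_cast Nat.succ_le_succ hk)
  -- Eventually `y k` is close to `y l`, through a large index of `z k` and `z l`.
  have hy : DiskCauchy 𝕜 D y := by
    intro ε hε
    obtain ⟨N, hN⟩ := small (ε / 3) (by positivity)
    obtain ⟨M, hM⟩ := hsub (ε / 3) (by positivity)
    refine ⟨max N M, fun k hk l hl => ?_⟩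
    obtain ⟨-, I, hI⟩ := unpack (hM k (le_of_max_le_right hk) l (le_of_max_le_right hl))
    let i := max I (max (n k) (n l))
    have e1 := hN k (le_of_max_le_left hk) i
      ((le_max_left _ _).trans (le_max_right _ _))
    have e2 := hN l (le_of_max_le_left hl) i
      ((le_max_right _ _).trans (le_max_right _ _))
    have e3 := hI i (le_max_left _ _)
    have e4 := hD.sub_mem (by positivity) (by positivity) e2 e1
    have e5 := hD.add_mem (by positivity) (by positivity) e3 e4
    have h1 : ε / 3 + (ε / 3 + ε / 3) = ε := by ring
    rw [h1] at e5
    have h2 : (z k - z l).1 i + ((z l).1 i - y l - ((z k).1 i - y k)) = y k - y l := by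
      change (z k).1 i - (z l).1 i + ((z l).1 i - y l - ((z k).1 i - y k)) = y k - y l
      abel
    rwa [h2] at e5
  have hlim : DiskTendsto 𝕜 (seqDisk D) z ⟨y, D, hDb, hD, hy⟩ := by
    intro ε hε
    obtain ⟨N, hN⟩ := small (ε / 2) (by positivity)
    obtain ⟨M, hM⟩ := hy (ε / 2) (by positivity)
    refine ⟨max N M, fun k hk => pack hε ?_ ⟨max (n k) (max N M), fun i hi => ?_⟩⟩
    · have := (hz k).comb hD hy 1 (-1)
      simp only [one_smul, neg_smul, ← sub_eq_add_neg] at this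
      exact this
    · have e1 := hN k (le_of_max_le_left hk) i (le_of_max_le_left hi)
      have e2 := hM k (le_of_max_le_right hk) i
        (le_of_max_le_right (le_of_max_le_right hi))
      have e3 := hD.add_mem (by positivity) (by positivity) e1 e2
      have h1 : ε / 2 + ε / 2 = ε := by ring
      rw [h1] at e3
      have h2 : (z k).1 i - y k + (y k - y i) = (z k).1 i - y i := by abel
      rw [h2] at e3
      exact e3
  refine ⟨⟨y, D, hDb, hD, hy⟩ + x K, fun ε hε => ?_⟩
  obtain ⟨N, hN⟩ := hlim ε hε
  refine ⟨K + N, fun k hk => ?_⟩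
  obtain ⟨l, rfl⟩ := Nat.exists_eq_add_of_le (show K ≤ k by omega)
  have := hN l (by omega)
  have h2 : z l - ⟨y, D, hDb, hD, hy⟩ = x (K + l) - (⟨y, D, hDb, hD, hy⟩ + x K) := by
    simp only [z]; abel
  rwa [h2] at this

/-- The underlying convex bornological vector space of the completion. -/
def comp (V : BornVec.{u} 𝕜) : BornVec.{u} 𝕜 := V.seqSpace.quot (closure ⊥)

theorem isComplete_comp (V : BornVec.{u} 𝕜) : V.comp.IsComplete := by
  refine isComplete_quot _ (isMackeyClosed_closure _) fun S hS => ?_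
  obtain ⟨D, hD, hD', h⟩ := isBounded_seqSpace.1 hS
  exact ⟨seqDisk D, isBounded_seqSpace.2 ⟨D, hD, hD', subset_rfl⟩, isDisk_seqDisk hD', h,
    fun x hx => seqSpace_lim hD' x hx hD⟩

theorem diskCauchy_const {D : Set V} (hD : IsDisk 𝕜 D) {w : V} (hw : w ∈ D) (v : V) :
    DiskCauchy 𝕜 D (fun _ => v) :=
  fun ε _ => ⟨0, fun _ _ _ _ => ⟨0, hD.zero_mem hw, by simp⟩⟩

/-- The constant sequences. -/
def constSeq (V : BornVec.{u} 𝕜) : boundedMaps V V.seqSpace :=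
  ⟨{ toFun := fun v => (⟨fun _ => v, by
        obtain ⟨D, hD, hD', h⟩ := V.exists_disk (isBounded_singleton (x := v))
        exact ⟨D, hD, hD', diskCauchy_const hD' (h rfl) v⟩⟩ : V.cauchySeq)
     map_add' := fun _ _ => rfl
     map_smul' := fun _ _ => rfl }, fun S hS => by
    obtain ⟨D, hD, hD', h⟩ := V.exists_disk hS
    refine isBounded_seqSpace.2 ⟨D, hD, hD', ?_⟩
    rintro _ ⟨v, hv, rfl⟩
    exact ⟨diskCauchy_const hD' (h hv) v, 0, fun _ _ => h hv⟩⟩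

/-- The canonical map to the completion. -/
def toComp (V : BornVec.{u} 𝕜) : boundedMaps V V.comp :=
  ⟨(quotMk _).1 ∘ₗ V.constSeq.1, fun S hS => by
    refine ((quotMk (V := V.seqSpace) (closure ⊥)).2 _ (V.constSeq.2 S hS)).subset ?_
    rintro _ ⟨v, hv, rfl⟩
    exact ⟨_, ⟨v, hv, rfl⟩, rfl⟩⟩

theorem exists_lim (hW : W.IsComplete) (f : boundedMaps V W) (x : V.cauchySeq) :
    ∃ w, MackeyTendsto (fun n => f.1 (x.1 n)) w := by
  obtain ⟨x, D, hD, -, hx⟩ := x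
  obtain ⟨E, hE, hE', h⟩ := hW (f.2 D hD)
  obtain ⟨w, hw⟩ := hE'.complete _ ((hx.map f.1).mono h)
  exact ⟨w, E, hE, hE'.disk, hw⟩

/-- The extension of a bounded linear map to Mackey-Cauchy sequences, by taking limits. -/
noncomputable def seqLift (hW : W.IsComplete) (f : boundedMaps V W) : V.cauchySeq →ₗ[𝕜] W where
  toFun x := (exists_lim hW f x).choose
  map_add' x y := hW.tendsto_unique (exists_lim hW f (x + y)).choose_spec (by
    have := (exists_lim hW f x).choose_spec.comb (exists_lim hW f y).choose_spec 1 1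
    simpa using this)
  map_smul' c x := hW.tendsto_unique (exists_lim hW f (c • x)).choose_spec (by
    have := (exists_lim hW f x).choose_spec.comb (exists_lim hW f x).choose_spec c 0
    simpa using this)

theorem seqLift_spec (hW : W.IsComplete) (f : boundedMaps V W) (x : V.cauchySeq) :
    MackeyTendsto (fun n => f.1 (x.1 n)) (seqLift hW f x) :=
  (exists_lim hW f x).choose_spec

theorem seqLift_mem (hW : W.IsComplete) (f : boundedMaps V W) {D : Set V} {E : Set W}
    (hE : IsBounded E) (hE' : IsCompletant 𝕜 E) (h : ∀ v ∈ D, f.1 v ∈ E) {x : V.cauchySeq}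
    (hx : x ∈ seqDisk D) : seqLift hW f x ∈ ((2 : ℝ) : 𝕜) • E := by
  obtain ⟨hx, N, hN⟩ := hx
  have hsub : f.1 '' D ⊆ E := by rintro _ ⟨v, hv, rfl⟩; exact h v hv
  obtain ⟨w, hw⟩ := hE'.complete _ ((hx.map f.1).mono hsub)
  have : seqLift hW f x = w := hW.tendsto_unique (seqLift_spec hW f x) ⟨E, hE, hE'.disk, hw⟩
  rw [this]
  exact hw.mem_two_smul hE'.disk ⟨N, fun n hn => h _ (hN n hn)⟩

/-- The extension of a bounded linear map to the completion. -/
noncomputable def compLift (hW : W.IsComplete) (f : boundedMaps V W) : boundedMaps V.comp W :=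
  let g : boundedMaps V.seqSpace W := ⟨seqLift hW f, fun S hS => by
    obtain ⟨D, hD, hD', hS⟩ := isBounded_seqSpace.1 hS
    obtain ⟨E, hE, hE', h⟩ := hW (f.2 D hD)
    refine (isBounded_const_smul ((2 : ℝ) : 𝕜) hE).subset ?_
    rintro _ ⟨x, hx, rfl⟩
    exact seqLift_mem hW f hE hE' (fun v hv => h ⟨v, hv, rfl⟩) (hS hx)⟩
  quotDesc _ g (closure_le (isMackeyClosed_ker hW g) bot_le)

@[simp]
theorem compLift_toComp (hW : W.IsComplete) (f : boundedMaps V W) (v : V) :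
    (compLift hW f).1 (V.toComp.1 v) = f.1 v := by
  refine hW.tendsto_unique (seqLift_spec hW f (V.constSeq.1 v)) ?_
  obtain ⟨D, hD, hD', h⟩ := W.exists_disk (isBounded_singleton (x := (0 : W)))
  exact ⟨D, hD, hD', fun ε _ => ⟨0, fun n _ => ⟨0, h rfl,
    (smul_zero _).trans (sub_self (f.1 v)).symm⟩⟩⟩

/-- Every element of the completion is a Mackey limit of elements of the space. -/
theorem exists_tendsto_comp (t : V.comp) :
    ∃ x : ℕ → V, MackeyTendsto (fun n => V.toComp.1 (x n)) t := by
  obtain ⟨x, rfl⟩ := Submodule.mkQ_surjective _ t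
  refine ⟨fun n => x.1 n, MackeyTendsto.map (V := V.seqSpace) (W := V.comp)
    (x := fun n => V.constSeq.1 (x.1 n)) (v := x) (quotMk _) ?_⟩
  obtain ⟨x, D, hD, hD', hx⟩ := x
  refine ⟨seqDisk D, isBounded_seqSpace.2 ⟨D, hD, hD', subset_rfl⟩, isDisk_seqDisk hD', ?_⟩
  intro ε hε
  have hε' : (ε : 𝕜) ≠ 0 := by exact_mod_cast hε.ne'
  obtain ⟨N, hN⟩ := hx ε hε
  refine ⟨N, fun n hn => (Set.mem_smul_set_iff_inv_smul_mem₀ hε' _ _).2 ⟨?_, N, fun m hm => ?_⟩⟩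
  · obtain ⟨d, hd, -⟩ := hN N le_rfl N le_rfl
    have := (diskCauchy_const hD' hd (x n)).comb hD' hx (ε : 𝕜)⁻¹ (-(ε : 𝕜)⁻¹)
    convert this using 2 with m
    change (ε : 𝕜)⁻¹ • (x n - x m) = _
    rw [smul_sub, neg_smul, sub_eq_add_neg]
  · exact (Set.mem_smul_set_iff_inv_smul_mem₀ hε' _ _).1 (hN n hn m hm)

/-- Maps out of the completion are determined by their restriction. -/
theorem comp_ext (hW : W.IsComplete) {f g : boundedMaps V.comp W}
    (h : ∀ v, f.1 (V.toComp.1 v) = g.1 (V.toComp.1 v)) : f = g := by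
  refine Subtype.ext (LinearMap.ext fun t => ?_)
  obtain ⟨x, hx⟩ := exists_tendsto_comp t
  have h1 := hx.map f
  simp only [h] at h1
  exact hW.tendsto_unique h1 (hx.map g)

/-- Equibounded families extend to equibounded families. -/
theorem isBounded_compLift {ι : Type*} (hW : W.IsComplete) (f : ι → boundedMaps V W) {I : Set ι}
    (hf : ∀ A : Set V, IsBounded A → IsBounded {w : W | ∃ i ∈ I, ∃ a ∈ A, (f i).1 a = w})
    {S : Set V.comp} (hS : IsBounded S) :
    IsBounded {w : W | ∃ i ∈ I, ∃ t ∈ S, (compLift hW (f i)).1 t = w} := by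
  obtain ⟨S', hS', -, hS⟩ := isBounded_quot.1 hS
  obtain ⟨D, hD, hD', hS'⟩ := isBounded_seqSpace.1 hS'
  obtain ⟨E, hE, hE', h⟩ := hW (hf D hD)
  refine (isBounded_const_smul ((2 : ℝ) : 𝕜) hE).subset ?_
  rintro _ ⟨i, hi, t, ht, rfl⟩
  obtain ⟨x, hx, rfl⟩ := hS ht
  exact seqLift_mem hW (f i) hE hE' (fun v hv => h ⟨i, hi, v, hv, rfl⟩) (hS' hx)

/-! ### The tensor product of convex bornological vector spaces -/

/-- A bilinear map is bounded if it maps products of bounded sets to bounded sets. -/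
def IsBoundedBilin (f : U →ₗ[𝕜] V →ₗ[𝕜] W) : Prop :=
  ∀ (A : Set U) (B : Set V), IsBounded A → IsBounded B →
    IsBounded (Set.image2 (fun u v => f u v) A B)

theorem exists_mem_diskHull_tmul (t : V ⊗[𝕜] W) :
    ∃ (A : Set V) (B : Set W), IsBounded A ∧ IsBounded B ∧
      t ∈ diskHull 𝕜 (Set.image2 (fun v w => v ⊗ₜ[𝕜] w) A B) := by
  induction t with
  | zero => exact ⟨{0}, {0}, isBounded_singleton, isBounded_singleton,
      subset_diskHull _ ⟨0, rfl, 0, rfl, by simp⟩⟩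
  | tmul v w => exact ⟨{v}, {w}, isBounded_singleton, isBounded_singleton,
      subset_diskHull _ ⟨v, rfl, w, rfl, rfl⟩⟩
  | add s t hs ht =>
    obtain ⟨A, B, hA, hB, hs⟩ := hs
    obtain ⟨A', B', hA', hB', ht⟩ := ht
    refine ⟨((2 : ℝ) : 𝕜) • (A ∪ A'), B ∪ B', isBounded_const_smul _ (hA.union hA'),
      hB.union hB', ?_⟩
    have hD := (isDisk_diskHull (𝕜 := 𝕜) (Set.image2 (fun v w => v ⊗ₜ[𝕜] w)
      (((2 : ℝ) : 𝕜) • (A ∪ A')) (B ∪ B'))).preimage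
      (((2 : ℝ) : 𝕜) • (LinearMap.id : V ⊗[𝕜] W →ₗ[𝕜] V ⊗[𝕜] W))
    have h1 := diskHull_subset hD (by
      rintro _ ⟨v, hv, w, hw, rfl⟩
      exact subset_diskHull _ ⟨((2 : ℝ) : 𝕜) • v, Set.smul_mem_smul_set (Or.inl hv), w,
        Or.inl hw, by simp [TensorProduct.smul_tmul']⟩) hs
    have h2 := diskHull_subset hD (by
      rintro _ ⟨v, hv, w, hw, rfl⟩
      exact subset_diskHull _ ⟨((2 : ℝ) : 𝕜) • v, Set.smul_mem_smul_set (Or.inr hv), w,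
        Or.inr hw, by simp [TensorProduct.smul_tmul']⟩) ht
    have := isDisk_diskHull (𝕜 := 𝕜) _ _ h1 _ h2 (1 / 2) (1 / 2) (by norm_num)
    convert this using 1
    have h2 : ((1 / 2 : 𝕜) * ((2 : ℝ) : 𝕜)) = 1 := by
      rw [RCLike.ofReal_ofNat]; norm_num
    simp only [LinearMap.smul_apply, LinearMap.id_apply, smul_smul, h2, one_smul]

/-- The tensor product: the algebraic tensor product, where a set is bounded if it is contained in
the disked hull of `A ⊗ B` for bounded sets `A` and `B`. (The disked hull of `A ⊗ B` is contained in
the convex hull of `A' ⊗ B`, where `A'` is the circled hull of `A ∪ {0}`.) -/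
def tensor (V W : BornVec.{u} 𝕜) : BornVec.{u} 𝕜 :=
  ofDisks (V ⊗[𝕜] W) {E | ∃ (A : Set V) (B : Set W), IsBounded A ∧ IsBounded B ∧
      diskHull 𝕜 (Set.image2 (fun v w => v ⊗ₜ[𝕜] w) A B) = E}
    (by rintro _ ⟨A, B, -, -, rfl⟩; exact isDisk_diskHull _)
    (by
      rintro _ ⟨A, B, hA, hB, rfl⟩ _ ⟨A', B', hA', hB', rfl⟩
      refine ⟨_, ⟨A ∪ A', B ∪ B', hA.union hA', hB.union hB', rfl⟩, Set.union_subset ?_ ?_⟩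
      · exact diskHull_subset (isDisk_diskHull _) ((Set.image2_subset Set.subset_union_left
          Set.subset_union_left).trans (subset_diskHull _))
      · exact diskHull_subset (isDisk_diskHull _) ((Set.image2_subset Set.subset_union_right
          Set.subset_union_right).trans (subset_diskHull _)))
    (by
      rintro _ ⟨A, B, hA, hB, rfl⟩ r -
      refine ⟨_, ⟨(r : 𝕜) • A, B, isBounded_const_smul _ hA, hB, rfl⟩, ?_⟩
      rintro _ ⟨t, ht, rfl⟩
      have hD := (isDisk_diskHull (𝕜 := 𝕜) (Set.image2 (fun v w => v ⊗ₜ[𝕜] w)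
        ((r : 𝕜) • A) B)).preimage
        ((r : 𝕜) • (LinearMap.id : V ⊗[𝕜] W →ₗ[𝕜] V ⊗[𝕜] W))
      refine diskHull_subset hD ?_ ht
      rintro _ ⟨v, hv, w, hw, rfl⟩
      exact subset_diskHull _ ⟨(r : 𝕜) • v, Set.smul_mem_smul_set hv, w, hw,
        by simp [TensorProduct.smul_tmul']⟩)
    (fun t => by
      obtain ⟨A, B, hA, hB, ht⟩ := exists_mem_diskHull_tmul t
      exact ⟨_, ⟨A, B, hA, hB, rfl⟩, ht⟩)

theorem isBounded_tensor {S : Set (V.tensor W)} :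
    IsBounded S ↔ ∃ (A : Set V) (B : Set W), IsBounded A ∧ IsBounded B ∧
      S ⊆ diskHull 𝕜 (V := V ⊗[𝕜] W) (Set.image2 (fun v w => v ⊗ₜ[𝕜] w) A B) := by
  refine (isBounded_ofDisks (V := V ⊗[𝕜] W)).trans ⟨?_, ?_⟩
  · rintro ⟨_, ⟨A, B, hA, hB, rfl⟩, h⟩; exact ⟨A, B, hA, hB, h⟩
  · rintro ⟨A, B, hA, hB, h⟩; exact ⟨_, ⟨A, B, hA, hB, rfl⟩, h⟩

/-- The universal bilinear map. -/
def tensorMk (V W : BornVec.{u} 𝕜) : V →ₗ[𝕜] W →ₗ[𝕜] V.tensor W := TensorProduct.mk 𝕜 V W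

theorem isBoundedBilin_tensorMk (V W : BornVec.{u} 𝕜) : IsBoundedBilin (V.tensorMk W) :=
  fun A B hA hB => isBounded_tensor.2 ⟨A, B, hA, hB, subset_diskHull (V := V ⊗[𝕜] W) _⟩

/-- Equibounded families of bilinear maps induce equibounded families of linear maps. -/
theorem isBounded_tensorLift {ι : Type*} (f : ι → U →ₗ[𝕜] V →ₗ[𝕜] W) {I : Set ι}
    (hf : ∀ (A : Set U) (B : Set V), IsBounded A → IsBounded B →
      IsBounded {w : W | ∃ i ∈ I, ∃ a ∈ A, ∃ b ∈ B, f i a b = w})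
    {S : Set (U.tensor V)} (hS : IsBounded S) :
    IsBounded {w : W | ∃ i ∈ I, ∃ t ∈ S, TensorProduct.lift (f i) t = w} := by
  obtain ⟨A, B, hA, hB, hS⟩ := isBounded_tensor.1 hS
  obtain ⟨D, hD, hD', h⟩ := W.exists_disk (hf A B hA hB)
  refine hD.subset ?_
  rintro _ ⟨i, hi, t, ht, rfl⟩
  refine diskHull_subset (hD'.preimage (TensorProduct.lift (f i))) ?_ (hS ht)
  rintro _ ⟨a, ha, b, hb, rfl⟩
  exact h ⟨i, hi, a, ha, b, hb, by simp⟩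

/-- The bounded linear map induced by a bounded bilinear map. -/
def tensorLift (f : U →ₗ[𝕜] V →ₗ[𝕜] W) (hf : IsBoundedBilin f) : boundedMaps (U.tensor V) W :=
  ⟨TensorProduct.lift f, fun S hS => by
    refine (isBounded_tensorLift (fun _ : Unit => f) (I := Set.univ) (fun A B hA hB =>
      (hf A B hA hB).subset ?_) hS).subset ?_
    · rintro _ ⟨-, -, a, ha, b, hb, rfl⟩; exact ⟨a, ha, b, hb, rfl⟩
    · rintro _ ⟨t, ht, rfl⟩; exact ⟨(), trivial, t, ht, rfl⟩⟩

end BornVec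

/-! ## The category of complete bornological vector spaces -/

/-- A complete convex bornological `𝕜`-vector space. -/
structure CBorn (𝕜 : Type) [RCLike 𝕜] : Type (u + 1) extends BornVec.{u} 𝕜 where
  isComplete : toBornVec.IsComplete

namespace CBorn

variable {𝕜 : Type} [RCLike 𝕜]

instance : CoeSort (CBorn.{u} 𝕜) (Type u) := ⟨fun X => X.toBornVec.carrier⟩

/-- The category of complete convex bornological vector spaces and bounded linear maps. -/
instance : Category (CBorn.{u} 𝕜) where
  Hom X Y := BornVec.boundedMaps X.toBornVec Y.toBornVec
  id X := ⟨LinearMap.id, fun S hS => by simpa using hS⟩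
  comp f g := ⟨g.1 ∘ₗ f.1, fun S hS => by
    rw [LinearMap.coe_comp, Set.image_comp]
    exact g.2 _ (f.2 S hS)⟩

variable {X Y Z X' Y' : CBorn.{u} 𝕜}

/-- The linear map that underlies a morphism. -/
def Hom.toLin (f : X ⟶ Y) : X →ₗ[𝕜] Y := Subtype.val f

instance : CoeFun (X ⟶ Y) (fun _ => X → Y) := ⟨fun f => Hom.toLin f⟩

@[simp] theorem id_apply (x : X) : (𝟙 X : X ⟶ X) x = x := rfl

@[simp] theorem comp_apply (f : X ⟶ Y) (g : Y ⟶ Z) (x : X) : (f ≫ g) x = g (f x) := rfl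

theorem hom_ext {f g : X ⟶ Y} (h : ∀ x, f x = g x) : f = g :=
  Subtype.ext (LinearMap.ext h)

/-! ### Coequalizers -/

/-- The quotient of `Y` by the closure of the range of `f - g`. -/
def coeq (f g : X ⟶ Y) : CBorn.{u} 𝕜 where
  toBornVec := Y.toBornVec.quot (BornVec.closure (LinearMap.range (Hom.toLin f - Hom.toLin g)))
  isComplete := BornVec.isComplete_quot _ (BornVec.isMackeyClosed_closure _) fun S hS => by
    obtain ⟨D, hD, hD', h⟩ := Y.isComplete hS
    exact ⟨D, hD, hD'.disk, h, hD'.complete⟩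

def coeqMk (f g : X ⟶ Y) : Y ⟶ coeq f g := BornVec.quotMk _

theorem coeq_condition (f g : X ⟶ Y) : f ≫ coeqMk f g = g ≫ coeqMk f g := by
  refine hom_ext fun x => (Submodule.Quotient.eq _).2 (BornVec.le_closure _ ⟨x, rfl⟩)

def coeqDesc (f g : X ⟶ Y) (h : Y ⟶ Z) (w : f ≫ h = g ≫ h) : coeq f g ⟶ Z :=
  BornVec.quotDesc _ h (BornVec.closure_le (BornVec.isMackeyClosed_ker Z.isComplete h) (by
    rintro _ ⟨x, rfl⟩
    have : h (f x) = h (g x) := congrArg (fun k : X ⟶ Z => k x) w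
    rw [LinearMap.mem_ker, LinearMap.sub_apply, map_sub, sub_eq_zero]
    exact this))

/-- The quotient of `Y` by the closure of the range of `f - g` is the coequalizer of `f` and `g`. -/
def coeqIsColimit (f g : X ⟶ Y) :
    IsColimit (Cofork.ofπ (coeqMk f g) (coeq_condition f g)) :=
  Cofork.IsColimit.mk _ (fun s => coeqDesc f g s.π s.condition)
    (fun s => hom_ext fun _ => rfl)
    (fun s m hm => hom_ext fun y => by
      obtain ⟨y, rfl⟩ := Submodule.mkQ_surjective _ y
      exact congrArg (fun k : Y ⟶ s.pt => k y) hm)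

instance : HasCoequalizers (CBorn.{u} 𝕜) :=
  @hasCoequalizers_of_hasColimit_parallelPair _ _ fun {_ _ f g} => ⟨⟨_, coeqIsColimit f g⟩⟩

/-! ### The complete tensor product -/

/-- The complete tensor product `X ⊗̂ Y`: the completion of the bornological tensor product. -/
def tensor (X Y : CBorn.{u} 𝕜) : CBorn.{u} 𝕜 :=
  ⟨(X.toBornVec.tensor Y.toBornVec).comp, BornVec.isComplete_comp _⟩

/-- The canonical bilinear map `X × Y → X ⊗̂ Y`. -/
def tmul (X Y : CBorn.{u} 𝕜) : X →ₗ[𝕜] Y →ₗ[𝕜] tensor X Y :=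
  (X.toBornVec.tensorMk Y.toBornVec).compr₂ (BornVec.toComp (X.toBornVec.tensor Y.toBornVec)).1

theorem isBoundedBilin_tmul (X Y : CBorn.{u} 𝕜) :
    BornVec.IsBoundedBilin (U := X.toBornVec) (V := Y.toBornVec) (W := (tensor X Y).toBornVec) (tmul X Y) :=
  fun A B hA hB => by
    refine ((BornVec.toComp (X.toBornVec.tensor Y.toBornVec)).2 _
      (BornVec.isBoundedBilin_tensorMk X.toBornVec Y.toBornVec A B hA hB)).subset ?_
    rintro _ ⟨a, ha, b, hb, rfl⟩
    exact ⟨_, ⟨a, ha, b, hb, rfl⟩, rfl⟩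

/-- The morphism `X ⊗̂ Y ⟶ Z` induced by a bounded bilinear map. -/
noncomputable def lift (f : X →ₗ[𝕜] Y →ₗ[𝕜] Z)
    (hf : BornVec.IsBoundedBilin (U := X.toBornVec) (V := Y.toBornVec) (W := Z.toBornVec) f) :
    tensor X Y ⟶ Z :=
  BornVec.compLift Z.isComplete (BornVec.tensorLift f hf)

@[simp]
theorem lift_tmul (f : X →ₗ[𝕜] Y →ₗ[𝕜] Z)
    (hf : BornVec.IsBoundedBilin (U := X.toBornVec) (V := Y.toBornVec) (W := Z.toBornVec) f) (x : X) (y : Y) :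
    lift f hf (tmul X Y x y) = f x y := by
  refine (BornVec.compLift_toComp Z.isComplete (BornVec.tensorLift f hf) _).trans ?_
  exact TensorProduct.lift.tmul x y

/-- Morphisms out of `X ⊗̂ Y` are determined by their values on the elements `x ⊗ y`. -/
theorem tensor_ext {f g : tensor X Y ⟶ Z}
    (h : ∀ x y, f (tmul X Y x y) = g (tmul X Y x y)) : f = g := by
  refine BornVec.comp_ext Z.isComplete fun t => ?_
  have : (Hom.toLin f ∘ₗ (BornVec.toComp (X.toBornVec.tensor Y.toBornVec)).1 : X ⊗[𝕜] Y →ₗ[𝕜] Z) =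
      Hom.toLin g ∘ₗ (BornVec.toComp (X.toBornVec.tensor Y.toBornVec)).1 :=
    TensorProduct.ext' h
  exact LinearMap.congr_fun this t

/-- The tensor product of morphisms, `x ⊗ y ↦ f(x) ⊗ g(y)`. -/
noncomputable def map (f : X ⟶ X') (g : Y ⟶ Y') : tensor X Y ⟶ tensor X' Y' :=
  lift ((tmul X' Y').compl₁₂ (Hom.toLin f) (Hom.toLin g)) fun A B hA hB => by
    refine (isBoundedBilin_tmul X' Y' _ _ (f.2 A hA) (g.2 B hB)).subset ?_
    rintro _ ⟨a, ha, b, hb, rfl⟩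
    exact ⟨_, ⟨a, ha, rfl⟩, _, ⟨b, hb, rfl⟩, rfl⟩

@[simp]
theorem map_tmul (f : X ⟶ X') (g : Y ⟶ Y') (x : X) (y : Y) :
    map f g (tmul X Y x y) = tmul X' Y' (f x) (g y) :=
  lift_tmul _ _ x y

/-- For fixed `z`, the bilinear map `(x, y) ↦ x ⊗ (y ⊗ z)`. -/
def assocBilin (X Y : CBorn.{u} 𝕜) (z : Z) : X →ₗ[𝕜] Y →ₗ[𝕜] tensor X (tensor Y Z) :=
  (tmul X (tensor Y Z)).compl₂ ((tmul Y Z).flip z)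

theorem isBoundedBilin_assocBilin (X Y : CBorn.{u} 𝕜) (z : Z) :
    BornVec.IsBoundedBilin (U := X.toBornVec) (V := Y.toBornVec)
      (W := (tensor X (tensor Y Z)).toBornVec) (assocBilin X Y z) := fun A B hA hB => by
  refine (isBoundedBilin_tmul X (tensor Y Z) A _ hA
    (isBoundedBilin_tmul Y Z B {z} hB isBounded_singleton)).subset ?_
  rintro _ ⟨a, ha, b, hb, rfl⟩
  exact ⟨a, ha, _, ⟨b, hb, z, rfl, rfl⟩, rfl⟩

/-- For fixed `z`, the morphism `X ⊗̂ Y ⟶ X ⊗̂ (Y ⊗̂ Z)`, `x ⊗ y ↦ x ⊗ (y ⊗ z)`. -/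
noncomputable def assocAux (X Y : CBorn.{u} 𝕜) (z : Z) : tensor X Y ⟶ tensor X (tensor Y Z) :=
  lift (assocBilin X Y z) (isBoundedBilin_assocBilin X Y z)

theorem assocAux_tmul (x : X) (y : Y) (z : Z) :
    assocAux X Y z (tmul X Y x y) = tmul X (tensor Y Z) x (tmul Y Z y z) :=
  lift_tmul _ _ x y

/-- The associator `(X ⊗̂ Y) ⊗̂ Z ⟶ X ⊗̂ (Y ⊗̂ Z)`, `(x ⊗ y) ⊗ z ↦ x ⊗ (y ⊗ z)`. -/
noncomputable def assoc (X Y Z : CBorn.{u} 𝕜) :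
    tensor (tensor X Y) Z ⟶ tensor X (tensor Y Z) :=
  lift (LinearMap.flip
    { toFun := fun z => Hom.toLin (assocAux X Y z)
      map_add' := fun z z' => by
        have : assocAux X Y (z + z') =
            (show BornVec.boundedMaps _ _ from assocAux X Y z) + assocAux X Y z' :=
          tensor_ext fun x y => by
            refine (assocAux_tmul x y _).trans ?_
            rw [map_add, map_add]
            exact congrArg₂ (· + ·) (assocAux_tmul x y z).symm (assocAux_tmul x y z').symm
        exact congrArg Subtype.val this
      map_smul' := fun c z => by
        have : assocAux X Y (c • z) = c • (show BornVec.boundedMaps _ _ from assocAux X Y z) :=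
          tensor_ext fun x y => by
            refine (assocAux_tmul x y _).trans ?_
            rw [map_smul, map_smul]
            exact congrArg (c • ·) (assocAux_tmul x y z).symm
        exact congrArg Subtype.val this }) fun S B hS hB => by
    refine (BornVec.isBounded_compLift (W := (tensor X (tensor Y Z)).toBornVec)
      (V := X.toBornVec.tensor Y.toBornVec) (ι := Z) (I := B)
      (tensor X (tensor Y Z)).isComplete (fun z =>
        BornVec.tensorLift (assocBilin X Y z) (isBoundedBilin_assocBilin X Y z))
      (fun T hT => ?_) hS).subset ?_
    · refine BornVec.isBounded_tensorLift (U := X.toBornVec) (V := Y.toBornVec)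
        (W := (tensor X (tensor Y Z)).toBornVec) (ι := Z) (I := B)
        (fun z => assocBilin X Y z) (fun A C hA hC => ?_) hT
      refine (isBoundedBilin_tmul X (tensor Y Z) A _ hA
        (isBoundedBilin_tmul Y Z C B hC hB)).subset ?_
      rintro _ ⟨z, hz, a, ha, c, hc, rfl⟩
      exact ⟨a, ha, _, ⟨c, hc, z, hz, rfl⟩, rfl⟩
    · rintro _ ⟨t, ht, z, hz, rfl⟩
      exact ⟨z, hz, t, ht, rfl⟩

@[simp]
theorem assoc_tmul (x : X) (y : Y) (z : Z) :
    assoc X Y Z (tmul (tensor X Y) Z (tmul X Y x y) z) =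
      tmul X (tensor Y Z) x (tmul Y Z y z) :=
  (lift_tmul _ _ _ _).trans (assocAux_tmul x y z)

end CBorn

/-! ## Algebras and modules in the category of complete bornological vector spaces -/

/-- A (not necessarily unital) algebra in complete bornological vector spaces. -/
structure CBornAlg (𝕜 : Type) [RCLike 𝕜] : Type (u + 1) where
  obj : CBorn.{u} 𝕜
  mul : CBorn.tensor obj obj ⟶ obj
  mul_assoc : CBorn.map mul (𝟙 obj) ≫ mul = CBorn.assoc obj obj obj ≫ CBorn.map (𝟙 obj) mul ≫ mul

variable {𝕜 : Type} [RCLike 𝕜]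

/-- A right module over an algebra. -/
structure CBornRightMod (A : CBornAlg.{u} 𝕜) : Type (u + 1) where
  obj : CBorn.{u} 𝕜
  act : CBorn.tensor obj A.obj ⟶ obj
  act_assoc : CBorn.map act (𝟙 A.obj) ≫ act =
    CBorn.assoc obj A.obj A.obj ≫ CBorn.map (𝟙 obj) A.mul ≫ act

/-- A left module over an algebra. -/
structure CBornLeftMod (A : CBornAlg.{u} 𝕜) : Type (u + 1) where
  obj : CBorn.{u} 𝕜
  act : CBorn.tensor A.obj obj ⟶ obj
  act_assoc : CBorn.map A.mul (𝟙 obj) ≫ act =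
    CBorn.assoc A.obj A.obj obj ≫ CBorn.map (𝟙 A.obj) act ≫ act

namespace CBornAlg

variable (A : CBornAlg.{u} 𝕜)

/-- The algebra as a left module over itself. -/
abbrev leftSelf : CBornLeftMod A := ⟨A.obj, A.mul, A.mul_assoc⟩

/-- Right multiplication `a ↦ a b`, as a morphism. -/
def rightMul (b : A.obj) : A.obj ⟶ A.obj :=
  ⟨CBorn.Hom.toLin A.mul ∘ₗ (CBorn.tmul A.obj A.obj).flip b, fun S hS => by
    refine (A.mul.2 _ (CBorn.isBoundedBilin_tmul A.obj A.obj S {b} hS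
      isBounded_singleton)).subset ?_
    rintro _ ⟨a, ha, rfl⟩
    exact ⟨_, ⟨a, ha, b, rfl, rfl⟩, rfl⟩⟩

/-- A sequence in `A` is a strong approximate right unit if the right multiplications with its terms
Mackey converge to the identity in the inner hom from `A` to `A`. -/
def IsStrongApproxRightUnit (e : ℕ → A.obj) : Prop :=
  BornVec.MackeyTendsto (V := BornVec.ihom A.obj.toBornVec A.obj.toBornVec) (fun n => A.rightMul (e n)) (𝟙 A.obj)

/-- The algebra has a (countable) strong approximate right unit. -/
def HasStrongApproxRightUnit : Prop := ∃ e : ℕ → A.obj, A.IsStrongApproxRightUnit e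

end CBornAlg

namespace CBornRightMod

variable {A : CBornAlg.{u} 𝕜} (M : CBornRightMod A)

/-- The tensor product `M ⊗̂_A N`: the coequalizer of the two maps `(M ⊗̂ A) ⊗̂ N ⟶ M ⊗̂ N`
given by the actions of `A` on `M` and on `N`. -/
noncomputable abbrev tensorOver (N : CBornLeftMod A) : CBorn.{u} 𝕜 :=
  coequalizer (CBorn.map M.act (𝟙 N.obj))
    (CBorn.assoc M.obj A.obj N.obj ≫ CBorn.map (𝟙 M.obj) N.act)

/-- The morphism `M ⊗̂_A A ⟶ M` induced by the action `M ⊗̂ A ⟶ M`. -/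
noncomputable def inducedAct : M.tensorOver A.leftSelf ⟶ M.obj :=
  coequalizer.desc M.act (M.act_assoc.trans (Category.assoc _ _ _).symm)

/-- A right module is smooth if `M ⊗̂_A A ⟶ M` is an isomorphism. -/
def IsSmooth : Prop := IsIso M.inducedAct

end CBornRightMod

/-! ### Bounded sets of the inner hom. -/

namespace BornVec

variable {𝕜 : Type} [RCLike 𝕜] {V W : BornVec.{u} 𝕜}

/-! Let π be the projection from `M ⊗̂ A` to `M ⊗̂_A A`, so that ρ is π followed by ρ̃
(`proj_inducedAct`). Two facts give injectivity of ρ̃. The first is algebraic: since π identifies `m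
⊗ ab` with `ma ⊗ b`, it satisfies π((id ⊗ r_b)(u)) = π(ρ(u) ⊗ b) for every u in `M ⊗̂ A`
(`map_rightMul_proj`). Hence ρ(u) = 0 forces (id ⊗ r_b)(u) into the kernel of π for every b. The
second is analytic: for fixed u the map f ↦ (id ⊗ f)(u) is linear and bounded on the inner hom
(`whiskerEval`), so it preserves Mackey convergence, and r_{e_n} → id becomes (id ⊗ r_{e_n})(u) → u.

Now let ρ̃(t) = 0. The coequalizer is a quotient of `M ⊗̂ A`, so t = π(u) for some u
(`coequalizer_π_surjective`), and ρ(u) = 0. Then u is a Mackey limit of elements of ker π. This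
kernel is Mackey closed, because limits are unique in the complete space `M ⊗̂_A A`. Therefore t =
π(u) = 0.

The second claim follows formally from ρ̃ being a monomorphism. As a coequalizer, π is a strong
epimorphism. If ρ̃ is invertible, its composite with π is again a strong epimorphism. If the
composite ρ is a strong epimorphism, so is its last factor ρ̃, and a strong epimorphism that is a
monomorphism is an isomorphism. -/

theorem isBounded_ihom {F : Set (ihom V W)} :
    IsBounded F ↔ ∀ A : Set V, IsBounded A →
      IsBounded {w : W | ∃ f ∈ F, ∃ a ∈ A, (show boundedMaps V W from f).1 a = w} :=
  Bornology.isBounded_ofBounded_iff (α := boundedMaps V W)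
    {F | ∀ A : Set V, IsBounded A → IsBounded {w : W | ∃ f ∈ F, ∃ a ∈ A, f.1 a = w}}
    (sUnion_univ := fun f A hA => (f.2 A hA).subset (by
      rintro w ⟨g, hg, a, ha, rfl⟩
      obtain rfl : g = f := hg
      exact ⟨a, ha, rfl⟩))

end BornVec

/-! ### Evaluation of `id ⊗ f` at a fixed tensor, and coequalizer projections. -/

namespace CBorn

variable {𝕜 : Type} [RCLike 𝕜] {X Y Z : CBorn.{u} 𝕜}

/-- The bounded linear map `f ↦ (id ⊗ f)(t)` on the inner hom. -/
noncomputable def whiskerEval (t : tensor X Y) :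
    BornVec.boundedMaps (BornVec.ihom Y.toBornVec Z.toBornVec) (tensor X Z).toBornVec :=
  ⟨{ toFun := fun f : BornVec.boundedMaps Y.toBornVec Z.toBornVec =>
        map (𝟙 X) (show Y ⟶ Z from f) t
     map_add' := fun f g => by
        -- An element `t` of the completion need not be a finite sum of elementary tensors.
        -- Additivity in `f` is therefore proved as an identity of morphisms, which `tensor_ext`
        -- reduces to elementary tensors, and evaluated at `t` only afterwards.
        have : map (𝟙 X) (show Y ⟶ Z from f + g) =
            (show BornVec.boundedMaps _ _ from map (𝟙 X) (show Y ⟶ Z from f)) +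
              map (𝟙 X) (show Y ⟶ Z from g) :=
          tensor_ext fun x y => by
            refine (map_tmul _ _ x y).trans ?_
            refine ((tmul X Z x).map_add (f.1 y) (g.1 y)).trans ?_
            exact congrArg₂ (· + ·) (map_tmul (𝟙 X) (show Y ⟶ Z from f) x y).symm
              (map_tmul (𝟙 X) (show Y ⟶ Z from g) x y).symm
        exact congrArg (fun k : tensor X Y ⟶ tensor X Z => k t) this
     map_smul' := fun c f => by
        have : map (𝟙 X) (show Y ⟶ Z from c • f) =
            c • (show BornVec.boundedMaps _ _ from map (𝟙 X) (show Y ⟶ Z from f)) :=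
          tensor_ext fun x y => by
            refine (map_tmul _ _ x y).trans ?_
            refine ((tmul X Z x).map_smul c (f.1 y)).trans ?_
            exact congrArg (c • ·) (map_tmul (𝟙 X) (show Y ⟶ Z from f) x y).symm
        exact congrArg (fun k : tensor X Y ⟶ tensor X Z => k t) this }, fun F hF => by
    -- Boundedness of each single `(x, y) ↦ x ⊗ f y` is needed just to form the extensions below;
    -- the uniform statement over `F` comes next.
    have hbilin : ∀ f : BornVec.boundedMaps Y.toBornVec Z.toBornVec,
        BornVec.IsBoundedBilin (U := X.toBornVec) (V := Y.toBornVec)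
          (W := (tensor X Z).toBornVec) ((tmul X Z).compl₂ f.1) := fun f A B hA hB => by
      refine (isBoundedBilin_tmul X Z _ _ hA (f.2 B hB)).subset ?_
      rintro _ ⟨a, ha, b, hb, rfl⟩
      exact ⟨a, ha, _, ⟨b, hb, rfl⟩, rfl⟩
    -- An equibounded family on the algebraic tensor product extends to an equibounded family on its
    -- completion. Applied to the maps `id ⊗ f` with `f ∈ F` and to the bounded set `{t}`, this
    -- bounds the image of `F`.
    refine (BornVec.isBounded_compLift (W := (tensor X Z).toBornVec)
      (V := X.toBornVec.tensor Y.toBornVec)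
      (ι := BornVec.boundedMaps Y.toBornVec Z.toBornVec) (I := F) (tensor X Z).isComplete
      (fun f => BornVec.tensorLift ((tmul X Z).compl₂ f.1) (hbilin f)) (fun T hT => ?_)
      (isBounded_singleton (x := t))).subset ?_
    · refine BornVec.isBounded_tensorLift (U := X.toBornVec) (V := Y.toBornVec)
        (W := (tensor X Z).toBornVec) (ι := BornVec.boundedMaps Y.toBornVec Z.toBornVec) (I := F)
        (fun f => (tmul X Z).compl₂ f.1) (fun A C hA hC => ?_) hT
      -- All values `a ⊗ f(c)` lie in `A ⊗ F(C)`, and boundedness of `F` in the inner hom says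
      -- exactly that such sets `F(C)` are bounded. This is where the equibounded bornology enters.
      refine (isBoundedBilin_tmul X Z A _ hA (BornVec.isBounded_ihom.1 hF C hC)).subset ?_
      rintro _ ⟨f, hf, a, ha, c, hc, rfl⟩
      exact ⟨a, ha, _, ⟨f, hf, c, hc, rfl⟩, rfl⟩
    · rintro _ ⟨f, hf, rfl⟩
      -- `map (𝟙 X) f` precomposes with the identity in the first variable, so it agrees
      -- definitionally with the extension of `(tmul X Z).compl₂ f.1`.
      exact ⟨f, hf, t, rfl, rfl⟩⟩

theorem whiskerEval_apply (t : tensor X Y) (f : Y ⟶ Z) :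
    (whiskerEval t).1 f = map (𝟙 X) f t := rfl

theorem map_id (X Y : CBorn.{u} 𝕜) : map (𝟙 X) (𝟙 Y) = 𝟙 (tensor X Y) :=
  tensor_ext fun x y => map_tmul _ _ x y

/-- The morphism `x ↦ x ⊗ y`. -/
def tmulRight (X : CBorn.{u} 𝕜) (y : Y) : X ⟶ tensor X Y :=
  ⟨(tmul X Y).flip y, fun S hS => by
    refine (isBoundedBilin_tmul X Y S {y} hS isBounded_singleton).subset ?_
    rintro _ ⟨a, ha, rfl⟩
    exact ⟨a, ha, y, rfl, rfl⟩⟩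

theorem tmulRight_apply (x : X) (y : Y) : tmulRight X y x = tmul X Y x y := rfl

theorem mono_of_injective (f : X ⟶ Y) (hf : Function.Injective (Hom.toLin f)) : Mono f :=
  ⟨fun _ _ w => hom_ext fun x => hf (congrArg (fun k => Hom.toLin k x) w)⟩

/-- Being an epimorphism is not enough here, since any morphism with dense range is one.
Surjectivity comes from the concrete model: the quotient of `Y` by the closure of the range of `f -
g` is already complete, so no further completion adds points outside the image. -/
theorem coequalizer_π_surjective (f g : X ⟶ Y) :
    Function.Surjective (Hom.toLin (coequalizer.π f g)) := fun t => by
  let e := (coequalizerIsCoequalizer f g).coconePointUniqueUpToIso (coeqIsColimit f g)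
  -- Choose a representative of `t` in the quotient model; transporting back along `e.inv` shows
  -- that the abstract projection sends it to `t`.
  obtain ⟨y, hy⟩ := Submodule.mkQ_surjective _ (e.hom t)
  have h : coeqMk f g ≫ e.inv = coequalizer.π f g :=
    IsColimit.comp_coconePointUniqueUpToIso_inv (coequalizerIsCoequalizer f g)
      (coeqIsColimit f g) WalkingParallelPair.one
  refine ⟨y, ?_⟩
  refine (congrArg (fun k => Hom.toLin k y) h).symm.trans ?_
  refine (congrArg (fun z => Hom.toLin e.inv z) hy).trans ?_
  exact congrArg (fun k => Hom.toLin k t) e.hom_inv_id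

end CBorn

/-! ### Injectivity of the induced action and the smoothness criterion. -/

namespace CBornRightMod

variable {𝕜 : Type} [RCLike 𝕜] {A : CBornAlg.{u} 𝕜} (M : CBornRightMod A)

/-- The projection `M ⊗̂ A ⟶ M ⊗̂_A A`. -/
noncomputable abbrev proj : CBorn.tensor M.obj A.obj ⟶ M.tensorOver A.leftSelf :=
  coequalizer.π (CBorn.map M.act (𝟙 A.obj))
    (CBorn.assoc M.obj A.obj A.obj ≫ CBorn.map (𝟙 M.obj) A.mul)

theorem proj_inducedAct : M.proj ≫ M.inducedAct = M.act :=
  coequalizer.π_desc _ _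

/-- In `M ⊗̂_A A` one has `m ⊗ a b = m a ⊗ b`. -/
theorem map_rightMul_proj (b : A.obj) :
    CBorn.map (𝟙 M.obj) (A.rightMul b) ≫ M.proj =
      M.act ≫ CBorn.tmulRight M.obj b ≫ M.proj :=
  CBorn.tensor_ext fun m a => by
    -- The coequalizer relation at `(m ⊗ a) ⊗ b` reads π(ma ⊗ b) = π(m ⊗ ab), and `A.rightMul b`
    -- sends `a` to `ab` by definition.
    have h := congrArg (fun k => CBorn.Hom.toLin k
      (CBorn.tmul _ A.obj (CBorn.tmul M.obj A.obj m a) b))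
      (coequalizer.condition (CBorn.map M.act (𝟙 A.obj))
        (CBorn.assoc M.obj A.obj A.obj ≫ CBorn.map (𝟙 M.obj) A.mul))
    simp only [CBorn.comp_apply, CBorn.map_tmul, CBorn.assoc_tmul, CBorn.id_apply] at h
    simp only [CBorn.comp_apply, CBorn.map_tmul, CBorn.id_apply, CBorn.tmulRight_apply]
    exact h.symm

/-- A representative `u` of a kernel element is approximated by (id ⊗ r_{e_n})(u), and each of these
dies in `M ⊗̂_A A` because the factor `e_n` can be moved across the tensor sign, leaving ρ(u) ⊗ e_n
= 0. -/
theorem inducedAct_injective (hA : A.HasStrongApproxRightUnit) :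
    Function.Injective (CBorn.Hom.toLin M.inducedAct) := by
  obtain ⟨e, he⟩ := hA
  rw [injective_iff_map_eq_zero]
  intro t ht
  obtain ⟨u, rfl⟩ := CBorn.coequalizer_π_surjective _ _ t
  have hu : CBorn.Hom.toLin M.act u = 0 := by
    rw [← M.proj_inducedAct]
    exact ht
  -- Convergence in the inner hom becomes convergence in `M ⊗̂ A`; the limit is (id ⊗ id)(u), which
  -- is `u` by `map_id`.
  have hlim := he.map (CBorn.whiskerEval (X := M.obj) u)
  -- It remains to see that every term of the sequence lies in the Mackey closed kernel of π.
  refine BornVec.isMackeyClosed_ker (M.tensorOver A.leftSelf).isComplete M.proj _ u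
    (fun n => ?_) (by simpa only [CBorn.whiskerEval_apply, CBorn.map_id, CBorn.id_apply] using hlim)
  have h := congrArg (fun k => CBorn.Hom.toLin k u) (M.map_rightMul_proj (e n))
  simp only [CBorn.comp_apply, hu, map_zero] at h
  exact h

end CBornRightMod

theorem proposition4 {𝕜 : Type} [RCLike 𝕜] (A : CBornAlg.{u} 𝕜) (hA : A.HasStrongApproxRightUnit)
    (M : CBornRightMod A) :
    Function.Injective (CBorn.Hom.toLin M.inducedAct) ∧ Mono M.inducedAct ∧
      (M.IsSmooth ↔ StrongEpi M.act) := by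
  have hinj := M.inducedAct_injective hA
  have hmono := CBorn.mono_of_injective _ hinj
  refine ⟨hinj, hmono, fun h => ?_, fun h => ?_⟩
  · have : IsIso M.inducedAct := h
    rw [← M.proj_inducedAct]
    -- The first factor is a coequalizer projection, hence a regular and so a strong epimorphism;
    -- the second is an isomorphism.
    exact strongEpi_comp _ _
  · rw [← M.proj_inducedAct] at h
    -- Strong epimorphisms pass to the last factor of a composite; with `hmono` this makes the
    -- induced action invertible.
    have := strongEpi_of_strongEpi M.proj M.inducedAct
    exact isIso_of_mono_of_strongEpi _
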